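/- **Setting.** Let $(\Omega,d,\mu)$ be a space of homogeneous type: $d:\Omega\times\Omega\to[0,\infty)$ is a quasi-metric ($d(x,y)=0$ iff $x=y$; $d(x,y)=d(y,x)$; $d(x,y)\le A_0(d(x,z)+d(z,y))$ for some constant $A_0>0$), all balls $B(x,r)=\{y: d(x,y)<r\}$, $r>0$, are open in the topology induced by $d$ (in which $G$ is open iff for every $x\in G$ there is $\varepsilon>0$ with $B(x,\varepsilon)\subset G$), and $\mu$ is a Borel measure for which there is a constant $A\ge1$ with $0<\mu(B(x,r))\le A\,\mu(B(x,r/2))<\infty$ for all $x\in\Omega$, $r>0$. Let $L^0$ be the space of measurable functions $\Omega\to\mathbb C$, identified when equal $\mu$-a.e. A quasi-Banach lattice $X$ over $(\Omega,d,\mu)$ is a linear subspace of $L^0$ with a quasi-norm $\|\cdot\|_X$ (a norm except that the triangle inequality is weakened to $\|f+g\|_X\le C(\|f\|_X+\|g\|_X)$ for a constant $C\ge1$) that is complete and such that $f\in X$, $g\in L^0$, $|g|\le|f|$ a.e. imply $g\in X$ and $\|g\|_X\le\|f\|_X$. It has the Fatou property if there is a constant $C_{\mathcal F}>0$ such that,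 whenever $f_n\in X$, $0\le f_n\uparrow f\in L^0$ a.e. and $\sup_n\|f_n\|_X<\infty$, one has $f\in X$ and $\|f\|_X\le C_{\mathcal F}\sup_n\|f_n\|_X$. For $r>0$, the convexification of $X$ is $X^{(r)}=\{f\in L^0: |f|^r\in X\}$ with the quasi-norm $\|f\|_{X^{(r)}}=\|\,|f|^r\|_X^{1/r}$. The maximal function is $Mf(x)=\sup_{B\ni x}\frac1{\mu(B)}\int_B|f|\,d\mu$, the supremum being over all balls $B$ that contain $x$. $M$ is bounded on $Y$ if there is a constant $C$ such that $Mf\in Y$ (in particular $Mf<\infty$ a.e.) and $\|Mf\|_Y\le C\|f\|_Y$ for all $f\in Y$; then $\|M\|_{Y\to Y}=\sup_{0\ne f\in Y}\|Mf\|_Y/\|f\|_Y$, read as $0$ if $Y=\{0\}$. **Theorem 1.1.** Let $X$ be a quasi-Banach lattice over a space of homogeneous type $(\Omega,d,\mu)$, and suppose that $X$ has the Fatou property. The following are equivalent: 1. $M$ is bounded on $X$. 2. For all $s>1$, $M$ is bounded on $X^{(s)}$, and $\lim_{s\to1^+}(s-1)\|M\|_{X^{(s)}\to X^{(s)}}=0$.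 3. There exists $r_0\in(0,1)$ such that $M$ is bounded on $X^{(r)}$ for every $r\in[r_0,1)$. -/

import Mathlib

open MeasureTheory Filter Topology
open scoped ENNReal

noncomputable section

/-! ### Spaces of homogeneous type -/

/-- `d` is a quasi-metric on `Ω`. -/
structure IsQuasiMetric {Ω : Type*} (d : Ω → Ω → ℝ) : Prop where
  nonneg : ∀ x y, 0 ≤ d x y
  eq_zero_iff : ∀ x y, d x y = 0 ↔ x = y
  symm : ∀ x y, d x y = d y x
  quasi_triangle : ∃ A₀ : ℝ, 0 < A₀ ∧ ∀ x y z, d x y ≤ A₀ * (d x z + d z y)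

/-- The ball `B(x, r) = {y : d(x, y) < r}`. -/
def qball {Ω : Type*} (d : Ω → Ω → ℝ) (x : Ω) (r : ℝ) : Set Ω := {y | d x y < r}

/-- `(Ω, d, μ)` is a space of homogeneous type: `d` is a quasi-metric all of whose balls are open in
the topology that `d` induces, and `μ` is a doubling measure on the Borel sets of that topology,
positive and finite on balls. -/
structure IsHomogeneousType {Ω : Type*} [TopologicalSpace Ω] [MeasurableSpace Ω] [BorelSpace Ω]
    (d : Ω → Ω → ℝ) (μ : Measure Ω) : Prop where
  quasiMetric : IsQuasiMetric d
  /-- The topology of `Ω` is the one induced by `d`. -/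
  isOpen_iff : ∀ U : Set Ω, IsOpen U ↔ ∀ x ∈ U, ∃ ε : ℝ, 0 < ε ∧ qball d x ε ⊆ U
  isOpen_ball : ∀ (x : Ω) (r : ℝ), 0 < r → IsOpen (qball d x r)
  doubling : ∃ A : ℝ, 1 ≤ A ∧ ∀ (x : Ω) (r : ℝ), 0 < r →
    0 < μ (qball d x r) ∧
    μ (qball d x r) ≤ ENNReal.ofReal A * μ (qball d x (r / 2)) ∧
    μ (qball d x r) < ∞

/-! ### Quasi-Banach lattices and convexifications -/

/-- A set of (classes of) complex measurable functions, with a real functional on it. Only the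
values of `qnorm` on `carrier` matter. -/
structure FunctionSpace {Ω : Type*} [MeasurableSpace Ω] (μ : Measure Ω) where
  carrier : Set (Ω →ₘ[μ] ℂ)
  qnorm : (Ω →ₘ[μ] ℂ) → ℝ

namespace FunctionSpace

variable {Ω : Type*} [MeasurableSpace Ω] {μ : Measure Ω}

/-- `X` is a quasi-normed lattice. -/
structure IsQuasiNormedLattice (X : FunctionSpace μ) : Prop where
  zero_mem : (0 : Ω →ₘ[μ] ℂ) ∈ X.carrier
  add_mem : ∀ f ∈ X.carrier, ∀ g ∈ X.carrier, f + g ∈ X.carrier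
  smul_mem : ∀ (c : ℂ), ∀ f ∈ X.carrier, c • f ∈ X.carrier
  nonneg : ∀ f ∈ X.carrier, 0 ≤ X.qnorm f
  eq_zero_iff : ∀ f ∈ X.carrier, X.qnorm f = 0 ↔ f = 0
  qnorm_smul : ∀ (c : ℂ), ∀ f ∈ X.carrier, X.qnorm (c • f) = ‖c‖ * X.qnorm f
  quasi_triangle : ∃ C : ℝ, 1 ≤ C ∧ ∀ f ∈ X.carrier, ∀ g ∈ X.carrier,
    X.qnorm (f + g) ≤ C * (X.qnorm f + X.qnorm g)
  lattice : ∀ f ∈ X.carrier, ∀ g : Ω →ₘ[μ] ℂ, (∀ᵐ x ∂μ, ‖g x‖ ≤ ‖f x‖) →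
    g ∈ X.carrier ∧ X.qnorm g ≤ X.qnorm f

/-- `X` is a quasi-Banach lattice: a complete quasi-normed lattice. -/
structure IsQuasiBanachLattice (X : FunctionSpace μ) : Prop extends IsQuasiNormedLattice X where
  complete : ∀ u : ℕ → (Ω →ₘ[μ] ℂ), (∀ n, u n ∈ X.carrier) →
    (∀ ε : ℝ, 0 < ε → ∃ N : ℕ, ∀ m ≥ N, ∀ n ≥ N, X.qnorm (u m - u n) < ε) →
    ∃ f ∈ X.carrier, Tendsto (fun n => X.qnorm (u n - f)) atTop (𝓝 0)

open scoped ComplexOrder in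
/-- The Fatou property: if `0 ≤ uₙ ↑ f` a.e. with `uₙ ∈ X` and `sup ‖uₙ‖ < ∞`, then `f ∈ X` and
`‖f‖ ≤ C sup ‖uₙ‖`. (In the order on `ℂ` used here, `0 ≤ z` means that `z` is real and nonnegative,
and `z ≤ w` means that `w - z` is.) -/
def HasFatouProperty (X : FunctionSpace μ) : Prop :=
  ∃ C : ℝ, 0 < C ∧ ∀ (u : ℕ → (Ω →ₘ[μ] ℂ)) (f : Ω →ₘ[μ] ℂ), (∀ n, u n ∈ X.carrier) →
    (∀ᵐ x ∂μ, (∀ n, 0 ≤ u n x) ∧ Monotone (fun n => u n x) ∧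
      Tendsto (fun n => u n x) atTop (𝓝 (f x))) →
    BddAbove (Set.range fun n => X.qnorm (u n)) →
    f ∈ X.carrier ∧ X.qnorm f ≤ C * ⨆ n, X.qnorm (u n)

/-- The class of the function `|f|^r`. -/
def absPow (f : Ω →ₘ[μ] ℂ) (r : ℝ) : Ω →ₘ[μ] ℂ :=
  AEEqFun.mk (fun x => ((‖f x‖ ^ r : ℝ) : ℂ))
    (Complex.measurable_ofReal.comp_aemeasurable
      (f.aestronglyMeasurable.norm.aemeasurable.pow_const r)).aestronglyMeasurable

/-- The convexification `X^{(r)} = {f : |f|^r ∈ X}` (for `r > 0`), with `‖f‖ = ‖ |f|^r ‖_X^{1/r}`. -/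
def convexification (X : FunctionSpace μ) (r : ℝ) : FunctionSpace μ where
  carrier := {f | absPow f r ∈ X.carrier}
  qnorm f := X.qnorm (absPow f r) ^ (1 / r)

end FunctionSpace

/-! ### The maximal operator -/

/-- The Hardy–Littlewood maximal function, the supremum of the averages of `|f|` over all balls
that contain the point `x`, as a function with values in `[0, ∞]`. -/
def maximalFunction {Ω : Type*} [MeasurableSpace Ω] (d : Ω → Ω → ℝ) (μ : Measure Ω)
    (f : Ω → ℂ) (x : Ω) : ℝ≥0∞ :=
  ⨆ (c : Ω) (r : ℝ) (_ : 0 < r) (_ : x ∈ qball d c r),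
    (∫⁻ y in qball d c r, ‖f y‖ₑ ∂μ) / μ (qball d c r)

/-- `Mf` is finite almost everywhere and `g` is its class. -/
def IsMaximalClass {Ω : Type*} [MeasurableSpace Ω] (d : Ω → Ω → ℝ) {μ : Measure Ω}
    (f g : Ω →ₘ[μ] ℂ) : Prop :=
  ∀ᵐ x ∂μ, maximalFunction d μ f x < ∞ ∧ g x = ((maximalFunction d μ f x).toReal : ℂ)

/-- `M` is bounded on `X`: for some constant `C`, every `f ∈ X` has `Mf ∈ X` and
`‖Mf‖_X ≤ C ‖f‖_X`. -/
def MaximalBoundedOn {Ω : Type*} [MeasurableSpace Ω] (d : Ω → Ω → ℝ) {μ : Measure Ω}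
    (X : FunctionSpace μ) : Prop :=
  ∃ C : ℝ, 0 ≤ C ∧ ∀ f ∈ X.carrier, ∃ g ∈ X.carrier,
    IsMaximalClass d f g ∧ X.qnorm g ≤ C * X.qnorm f

/-- The operator quasi-norm `‖M‖_{X → X}`, the supremum of `‖Mf‖_X / ‖f‖_X` over nonzero `f ∈ X`
(zero if there is no such `f`); meaningful when `M` is bounded on `X`. -/
def maximalOpNorm {Ω : Type*} [MeasurableSpace Ω] (d : Ω → Ω → ℝ) {μ : Measure Ω}
    (X : FunctionSpace μ) : ℝ :=
  sSup {t : ℝ | ∃ f ∈ X.carrier, f ≠ 0 ∧ ∃ g ∈ X.carrier,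
    IsMaximalClass d f g ∧ t = X.qnorm g / X.qnorm f}

end

noncomputable section

/-! Jensen's inequality, `ballMaximal_rpow_le_ballMaximal_rpow`, carries boundedness of M from one
exponent to every larger one without increasing the constant of the r-th power estimate
(`MaximalMajorized.of_le`). This gives 1 → 2, since the operator norms stay bounded as s → 1, and 3
→ 1.

The content is 2 → 3. Let Q bound the norm of M on X^(s). Summing the iterates of M, Rubio de
Francia's construction (`MaximalMajorized.exists_weight`) majorizes f by a weight w with Mw ≤ 4CQ w,
where C is the quasi-triangle constant of X, and with w^s controlled in X by |f|^s. Such an A₁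
weight improves itself: M(w^(1+δ)) ≲ (Mw)^(1+δ) with δ a fixed multiple of 1/Q
(`ballMaximal_rpow_le`). Applied to f = |g|^(1/(1+δ)), this yields (Mg)^r ≲ w^s with r = s/(1+δ), so
M is bounded on X^(r). The hypothesis on (s - 1)‖M‖ says exactly that some s satisfies s - 1 < δ,
that is r < 1.

The linear dependence on Q is essential in both steps. For the self-improvement it comes from a
reverse weak-type inequality (`setLIntegral_lt_ballMaximal_le`), integrated over the levels and
closed by absorption. -/

/-- The maximal function of a function with values in `[0, ∞]`. -/
def ballMaximal {Ω : Type*} [MeasurableSpace Ω] (d : Ω → Ω → ℝ) (μ : Measure Ω)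
    (w : Ω → ℝ≥0∞) (x : Ω) : ℝ≥0∞ :=
  ⨆ (c : Ω) (r : ℝ) (_ : 0 < r) (_ : x ∈ qball d c r),
    (∫⁻ y in qball d c r, w y ∂μ) / μ (qball d c r)

/-! ### Engulfing and doubling of balls. -/

/-- The geometric facts about balls from which the covering arguments proceed: a ball that meets a
ball of at least half its radius is contained in the `K`-fold enlargement of the latter, and the
enlargement increases the measure at most by the factor `D`. -/
structure HasEnlargement {Ω : Type*} [TopologicalSpace Ω] [MeasurableSpace Ω]
    (d : Ω → Ω → ℝ) (μ : Measure Ω) (K : ℝ) (D : ℝ≥0∞) : Prop where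
  two_le : 2 ≤ K
  one_le : 1 ≤ D
  ne_top : D ≠ ∞
  mem_self : ∀ x r, 0 < r → x ∈ qball d x r
  isOpen_ball : ∀ x r, 0 < r → IsOpen (qball d x r)
  exists_ball : ∀ U : Set Ω, IsOpen U → ∀ x ∈ U, ∃ ε : ℝ, 0 < ε ∧ qball d x ε ⊆ U
  symm : ∀ x y, d x y = d y x
  subset : ∀ x y r s, r ≤ 2 * s → (qball d x r ∩ qball d y s).Nonempty →
    qball d x r ⊆ qball d y (K * s)
  pos : ∀ x r, 0 < r → 0 < μ (qball d x r)
  lt_top : ∀ x r, μ (qball d x r) < ∞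
  measure_le : ∀ x r, 0 < r → μ (qball d x (K * r)) ≤ D * μ (qball d x r)

theorem qball_mono {Ω : Type*} {d : Ω → Ω → ℝ} {x : Ω} {r s : ℝ} (h : r ≤ s) :
    qball d x r ⊆ qball d x s := fun _ hy => lt_of_lt_of_le hy h

theorem IsHomogeneousType.exists_enlargement {Ω : Type*} [TopologicalSpace Ω] [MeasurableSpace Ω]
    [BorelSpace Ω] {d : Ω → Ω → ℝ} {μ : Measure Ω} (h : IsHomogeneousType d μ) :
    ∃ K D, HasEnlargement d μ K D := by
  obtain ⟨A₀, hA₀, htri⟩ := h.quasiMetric.quasi_triangle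
  obtain ⟨A, hA, hdoub⟩ := h.doubling
  have hsymm := h.quasiMetric.symm
  -- Two applications of the quasi-triangle inequality bound the distance from y by A₀(s + 4A₀s);
  -- the summand 2 secures 2 ≤ K. A power of two lets the doubling condition be iterated m times.
  obtain ⟨m, hm⟩ := pow_unbounded_of_one_lt (A₀ + 4 * A₀ ^ 2 + 2) (one_lt_two (α := ℝ))
  have hit : ∀ (n : ℕ) (x : Ω) (r : ℝ), 0 < r →
      μ (qball d x (2 ^ n * r)) ≤ ENNReal.ofReal A ^ n * μ (qball d x r) := by
    intro n
    induction n with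
    | zero => intro x r _; simp
    | succ n ih =>
      intro x r hr
      have h1 := (hdoub x (2 ^ (n + 1) * r) (by positivity)).2.1
      have h2 : (2 : ℝ) ^ (n + 1) * r / 2 = 2 ^ n * r := by ring
      rw [h2] at h1
      calc _ ≤ _ := h1
        _ ≤ ENNReal.ofReal A * (ENNReal.ofReal A ^ n * μ (qball d x r)) := by gcongr; exact ih x r hr
        _ = _ := by ring
  refine ⟨2 ^ m, ENNReal.ofReal A ^ m, ⟨by nlinarith, ?_, by finiteness, ?_, h.isOpen_ball,
    fun U hU => (h.isOpen_iff U).1 hU, hsymm, ?_, fun x r hr => (hdoub x r hr).1, ?_, hit m⟩⟩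
  · exact one_le_pow₀ (by simpa using hA)
  · intro x r hr
    simpa [qball, (h.quasiMetric.eq_zero_iff x x).2 rfl] using hr
  · rintro x y r s hrs ⟨u, hu, hu'⟩ z hz
    simp only [qball, Set.mem_ofPred_eq] at *
    have h1 := htri y z u
    have h2 := htri u z x
    rw [hsymm u x] at h2
    have hs : 0 < s := lt_of_le_of_lt (h.quasiMetric.nonneg _ _) hu'
    have h3 : d u z ≤ A₀ * (4 * s) := h2.trans (by gcongr; linarith)
    have h4 : A₀ * (d y u + d u z) ≤ A₀ * (s + A₀ * (4 * s)) := by gcongr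
    nlinarith [mul_lt_mul_of_pos_right hm hs]
  · intro x r
    rcases lt_or_ge 0 r with hr | hr
    · exact (hdoub x r hr).2.2
    · exact lt_of_le_of_lt (measure_mono (qball_mono (hr.trans zero_le_one)))
        (hdoub x 1 one_pos).2.2

/-! ### Covering arguments and weak-type estimates. -/

section Covering

variable {Ω : Type*} [TopologicalSpace Ω] [MeasurableSpace Ω] {d : Ω → Ω → ℝ} {μ : Measure Ω}
  {K : ℝ} {D : ℝ≥0∞}

theorem lintegral_ball_le_ballMaximal_mul (h : HasEnlargement d μ K D) (w : Ω → ℝ≥0∞) {x c : Ω}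
    {r : ℝ} (hr : 0 < r) (hx : x ∈ qball d c r) :
    ∫⁻ y in qball d c r, w y ∂μ ≤ ballMaximal d μ w x * μ (qball d c r) := by
  have h1 : (∫⁻ y in qball d c r, w y ∂μ) / μ (qball d c r) ≤ ballMaximal d μ w x :=
    le_iSup_of_le c (le_iSup_of_le r (le_iSup_of_le hr (le_iSup_of_le hx le_rfl)))
  exact (ENNReal.div_le_iff_le_mul (Or.inl (h.pos c r hr).ne') (Or.inl (h.lt_top c r).ne)).1 h1

theorem ballMaximal_le (h : HasEnlargement d μ K D) {w : Ω → ℝ≥0∞} {x : Ω} {a : ℝ≥0∞}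
    (ha : ∀ c r, 0 < r → x ∈ qball d c r → ∫⁻ y in qball d c r, w y ∂μ ≤ a * μ (qball d c r)) :
    ballMaximal d μ w x ≤ a :=
  iSup_le fun c => iSup_le fun r => iSup_le fun hr => iSup_le fun hx =>
    (ENNReal.div_le_iff_le_mul (Or.inl (h.pos c r hr).ne') (Or.inl (h.lt_top c r).ne)).2
      (ha c r hr hx)

theorem lt_ballMaximal_iff (h : HasEnlargement d μ K D) {w : Ω → ℝ≥0∞} {x : Ω} {a : ℝ≥0∞} :
    a < ballMaximal d μ w x ↔ ∃ c r, 0 < r ∧ x ∈ qball d c r ∧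
      a * μ (qball d c r) < ∫⁻ y in qball d c r, w y ∂μ := by
  constructor
  · contrapose!
    exact fun H => ballMaximal_le h H
  · rintro ⟨c, r, hr, hx, hlt⟩
    by_contra! H
    exact absurd (lintegral_ball_le_ballMaximal_mul h w hr hx) (not_le.2 (lt_of_le_of_lt
      (by gcongr) hlt))

/-- For the uncentred operator every superlevel set is a union of balls, hence open, whatever w is.
-/
theorem measurable_ballMaximal [BorelSpace Ω] (h : HasEnlargement d μ K D) (w : Ω → ℝ≥0∞) :
    Measurable (ballMaximal d μ w) := by
  refine measurable_of_Ioi fun a => IsOpen.measurableSet ?_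
  have : ballMaximal d μ w ⁻¹' Set.Ioi a = ⋃ (c : Ω) (r : ℝ) (_ : 0 < r)
      (_ : a * μ (qball d c r) < ∫⁻ y in qball d c r, w y ∂μ), qball d c r := by
    ext x
    simp only [Set.mem_preimage, Set.mem_Ioi, lt_ballMaximal_iff h, Set.mem_iUnion, exists_prop]
    exact exists_congr fun c => exists_congr fun r => by tauto
  rw [this]
  exact isOpen_iUnion fun c => isOpen_iUnion fun r => isOpen_iUnion fun hr => isOpen_iUnion fun _ =>
    h.isOpen_ball c r hr

omit [TopologicalSpace Ω] in
theorem ballMaximal_mono_ae {w v : Ω → ℝ≥0∞} (hwv : w ≤ᵐ[μ] v) (x : Ω) :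
    ballMaximal d μ w x ≤ ballMaximal d μ v x :=
  iSup_mono fun _ => iSup_mono fun _ => iSup_mono fun _ => iSup_mono fun _ => by
    gcongr ?_ / _
    exact lintegral_mono_ae (ae_restrict_of_ae hwv)

theorem ballMaximal_const_mul_le (h : HasEnlargement d μ K D) {a : ℝ≥0∞} (ha : a ≠ ∞)
    (w : Ω → ℝ≥0∞) (x : Ω) :
    ballMaximal d μ (fun y => a * w y) x ≤ a * ballMaximal d μ w x := by
  refine ballMaximal_le h fun c r hr hx => ?_
  rw [lintegral_const_mul' _ _ ha, mul_assoc]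
  gcongr
  exact lintegral_ball_le_ballMaximal_mul h w hr hx

theorem ballMaximal_tsum_le (h : HasEnlargement d μ K D) {w : ℕ → Ω → ℝ≥0∞}
    (hw : ∀ n, AEMeasurable (w n) μ) (x : Ω) :
    ballMaximal d μ (fun y => ∑' n, w n y) x ≤ ∑' n, ballMaximal d μ (w n) x := by
  refine ballMaximal_le h fun c r hr hx => ?_
  rw [lintegral_tsum fun n => (hw n).restrict, ← ENNReal.tsum_mul_right]
  exact ENNReal.tsum_le_tsum fun n => lintegral_ball_le_ballMaximal_mul h (w n) hr hx

omit [TopologicalSpace Ω] [MeasurableSpace Ω] in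
theorem iUnion_qball (hne : Nonempty Ω) :
    ∃ c : Ω, Set.univ ⊆ ⋃ n : ℕ, qball d c (n + 1) := by
  obtain ⟨c⟩ := hne
  refine ⟨c, fun x _ => ?_⟩
  obtain ⟨n, hn⟩ := exists_nat_gt (d c x)
  exact Set.mem_iUnion.2 ⟨n, show d c x < n + 1 by linarith⟩

theorem HasEnlargement.sigmaFinite [OpensMeasurableSpace Ω] (h : HasEnlargement d μ K D) :
    SigmaFinite μ := by
  rcases isEmpty_or_nonempty Ω with hE | hne
  · rw [Measure.eq_zero_of_isEmpty μ]; infer_instance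
  obtain ⟨c, hc⟩ := iUnion_qball (d := d) hne
  exact ⟨⟨⟨fun n => qball d c (n + 1), fun _ => trivial, fun n => h.lt_top _ _,
    Set.univ_subset_iff.1 hc⟩⟩⟩

/-- The Vitali covering argument: local estimates on enlarged balls add up to a global one. -/
theorem measure_le_of_covering [OpensMeasurableSpace Ω] (h : HasEnlargement d μ K D)
    {ν : Measure Ω} {S V : Set Ω} {t : Set (Ω × ℝ)} {R : ℝ} {a : ℝ≥0∞}
    (hpos : ∀ p ∈ t, 0 < p.2) (hR : ∀ p ∈ t, p.2 ≤ R)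
    (hS : S ⊆ ⋃ p ∈ t, qball d p.1 p.2) (hV : ∀ p ∈ t, qball d p.1 p.2 ⊆ V)
    (hν : ∀ p ∈ t, ν (S ∩ qball d p.1 (K * p.2)) ≤ a * μ (qball d p.1 (K * p.2))) :
    ν S ≤ a * D * μ V := by
  have := h.sigmaFinite
  -- The ratio 2 of radii is the one that the engulfing property `h.subset` allows.
  obtain ⟨u, hut, hdisj, hu⟩ := Vitali.exists_disjoint_subfamily_covering_enlargement
    (fun p : Ω × ℝ => qball d p.1 p.2) t (fun p => p.2) 2 one_lt_two (fun p hp => (hpos p hp).le)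
    R hR (fun p hp => ⟨p.1, h.mem_self _ _ (hpos p hp)⟩)
  have hmeas : ∀ p ∈ u, MeasurableSet (qball d p.1 p.2) := fun p hp =>
    (h.isOpen_ball _ _ (hpos p (hut hp))).measurableSet
  have hcount : u.Countable := by
    have h1 := Measure.countable_meas_pos_of_disjoint_iUnion (μ := μ)
      (As := fun p : u => qball d p.1.1 p.1.2) (fun p => hmeas p p.2)
      (fun p q hpq => hdisj p.2 q.2 (fun e => hpq (Subtype.ext e)))
    have h2 : {i : u | 0 < μ (qball d i.1.1 i.1.2)} = Set.univ :=
      Set.eq_univ_of_forall fun p => h.pos _ _ (hpos _ (hut p.2))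
    rw [h2, Set.countable_univ_iff] at h1
    exact Set.countable_coe_iff.1 h1
  have := hcount.to_subtype
  have hcov : S ⊆ ⋃ p : u, S ∩ qball d p.1.1 (K * p.1.2) := by
    intro x hx
    obtain ⟨p, hp, hxp⟩ := Set.mem_iUnion₂.1 (hS hx)
    obtain ⟨q, hq, hne, hle⟩ := hu p hp
    exact Set.mem_iUnion.2 ⟨⟨q, hq⟩, hx, h.subset _ _ _ _ hle hne hxp⟩
  calc ν S ≤ ∑' p : u, ν (S ∩ qball d p.1.1 (K * p.1.2)) :=
        (measure_mono hcov).trans (measure_iUnion_le _)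
    _ ≤ ∑' p : u, a * D * μ (qball d p.1.1 p.1.2) := by
        refine ENNReal.tsum_le_tsum fun p => (hν _ (hut p.2)).trans ?_
        rw [mul_assoc]
        gcongr
        exact h.measure_le _ _ (hpos _ (hut p.2))
    _ = a * D * μ (⋃ p ∈ u, qball d p.1 p.2) := by
        rw [ENNReal.tsum_mul_left, measure_biUnion hcount hdisj hmeas]
    _ ≤ a * D * μ V := by
        gcongr
        exact Set.iUnion₂_subset fun p hp => hV p (hut hp)

/-- Every open U is the increasing union of the closed sets of points at distance at least 1/(k+1)
from the complement; closedness uses that balls are open. This makes the restriction of μ to a ball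
weakly regular, and countably many balls exhaust Ω. -/
theorem HasEnlargement.outerRegular [BorelSpace Ω] (h : HasEnlargement d μ K D) :
    μ.OuterRegular := by
  rcases isEmpty_or_nonempty Ω with hE | hne
  · rw [Measure.eq_zero_of_isEmpty μ]; infer_instance
  obtain ⟨c, hc⟩ := iUnion_qball (d := d) hne
  refine Measure.OuterRegular.of_restrict (s := fun n : ℕ => qball d c (n + 1)) (fun n => ?_)
    (fun n => h.isOpen_ball _ _ (by positivity)) hc
  have : IsFiniteMeasure (μ.restrict (qball d c (n + 1))) :=
    ⟨by rw [Measure.restrict_apply_univ]; exact h.lt_top _ _⟩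
  have : (μ.restrict (qball d c (n + 1))).WeaklyRegular := by
    refine Measure.InnerRegularWRT.weaklyRegular_of_finite _ fun U hU r hr => ?_
    set F : ℕ → Set Ω := fun k => (⋃ z ∈ Uᶜ, qball d z (1 / ((k : ℝ) + 1)))ᶜ with hFdef
    have hF : ∀ k, IsClosed (F k) := fun k => (isOpen_biUnion fun z _ =>
      h.isOpen_ball z _ (by positivity)).isClosed_compl
    have hmem : ∀ k x, x ∈ F k ↔ ∀ z ∉ U, 1 / ((k : ℝ) + 1) ≤ d z x := by
      intro k x
      simp [hFdef, qball]
    have hFU : ∀ k, F k ⊆ U := by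
      intro k x hx
      by_contra hxU
      exact hx (Set.mem_biUnion (show x ∈ Uᶜ from hxU) (h.mem_self x _ (by positivity)))
    have hmono : Monotone F := by
      intro k l hkl x hx
      rw [hmem] at hx ⊢
      exact fun z hz => (one_div_le_one_div_of_le (by positivity) (by gcongr)).trans (hx z hz)
    have hUF : U = ⋃ k, F k := by
      refine Set.Subset.antisymm (fun x hx => ?_) (Set.iUnion_subset hFU)
      obtain ⟨ε, hε, hsub⟩ := h.exists_ball U hU x hx
      obtain ⟨k, hk⟩ := exists_nat_one_div_lt hε
      refine Set.mem_iUnion.2 ⟨k, (hmem k x).2 fun z hz => ?_⟩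
      by_contra! hlt
      exact hz (hsub (show d x z < ε by rw [h.symm]; linarith))
    rw [hUF, hmono.measure_iUnion, lt_iSup_iff] at hr
    obtain ⟨k, hk⟩ := hr
    exact ⟨F k, hFU k, hF k, hk⟩
  infer_instance

/-- A substitute for Lebesgue's differentiation theorem. -/
theorem ae_le_ballMaximal [BorelSpace Ω] (h : HasEnlargement d μ K D) {w : Ω → ℝ≥0∞}
    (hw : AEMeasurable w μ) : ∀ᵐ x ∂μ, w x ≤ 2 * D * ballMaximal d μ w x := by
  wlog hwm : Measurable w generalizing w
  · filter_upwards [this hw.measurable_mk.aemeasurable hw.measurable_mk, hw.ae_eq_mk] with x h1 h2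
    rw [h2]
    exact h1.trans (by gcongr; exact ballMaximal_mono_ae hw.ae_eq_mk.symm.le x)
  rcases isEmpty_or_nonempty Ω with hE | hne
  · exact ae_of_all _ fun x => hE.elim x
  have := h.outerRegular
  have hD0 : 2 * D ≠ 0 := by simpa using (zero_lt_one.trans_le h.one_le).ne'
  have hDt : 2 * D ≠ ∞ := by have := h.ne_top; finiteness
  obtain ⟨c, hc⟩ := iUnion_qball (d := d) hne
  have key : ∀ (q : NNReal) (n : ℕ),
      μ ({x | 2 * D * ballMaximal d μ w x < q ∧ q < w x} ∩ qball d c (n + 1)) = 0 := by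
    intro q n
    set G := {x | 2 * D * ballMaximal d μ w x < q ∧ q < w x} ∩ qball d c (n + 1) with hG
    have hGt : μ G ≠ ∞ := ((measure_mono Set.inter_subset_right).trans_lt (h.lt_top _ _)).ne
    have hGm : MeasurableSet G :=
      ((measurableSet_lt (measurable_const.mul (measurable_ballMaximal h w)) measurable_const).inter
        (measurableSet_lt measurable_const hwm)).inter (h.isOpen_ball _ _ (by positivity)).measurableSet
    by_contra hG0
    -- Balls centred in G and contained in U give μ G ≤ (2D)⁻¹ D μ U = μ U / 2, which contradicts μ
    -- U < 2 μ G.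
    obtain ⟨U, hGU, hU, hμU⟩ := G.exists_isOpen_lt_of_lt (2 * μ G) (by
      rw [two_mul]; exact ENNReal.lt_add_right hGt hG0)
    have hle : μ G ≤ (2 * D)⁻¹ * D * μ U := by
      refine measure_le_of_covering h (S := G) (V := U) (R := 1)
        (t := {p | p.1 ∈ G ∧ 0 < p.2 ∧ p.2 ≤ 1 ∧ qball d p.1 p.2 ⊆ U})
        (fun p hp => hp.2.1) (fun p hp => hp.2.2.1) (fun x hx => ?_) (fun p hp => hp.2.2.2)
        (fun p hp => ?_)
      · obtain ⟨ε, hε, hsub⟩ := h.exists_ball U hU x (hGU hx)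
        exact Set.mem_biUnion (x := (x, min ε 1)) ⟨hx, lt_min hε one_pos, min_le_right _ _,
          (qball_mono (min_le_left _ _)).trans hsub⟩ (h.mem_self _ _ (lt_min hε one_pos))
      · obtain ⟨⟨⟨hM, hqw⟩, -⟩, hp, -, -⟩ := hp
        have hKp : 0 < K * p.2 := by have := h.two_le; positivity
        have hq0 : (q : ℝ≥0∞) ≠ 0 := (zero_le.trans_lt hM).ne'
        set B := qball d p.1 (K * p.2)
        have h1 : q * μ (G ∩ B) ≤ ballMaximal d μ w p.1 * μ B :=
          calc q * μ (G ∩ B) = ∫⁻ _ in G ∩ B, q ∂μ := by simp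
            _ ≤ ∫⁻ y in G ∩ B, w y ∂μ := setLIntegral_mono hwm fun y hy => hy.1.1.2.le
            _ ≤ ∫⁻ y in B, w y ∂μ := lintegral_mono_set Set.inter_subset_right
            _ ≤ _ := lintegral_ball_le_ballMaximal_mul h w hKp (h.mem_self _ _ hKp)
        have h2 : ballMaximal d μ w p.1 ≤ (2 * D)⁻¹ * q := by
          rw [mul_comm, ← div_eq_mul_inv, ENNReal.le_div_iff_mul_le (Or.inl hD0) (Or.inl hDt),
            mul_comm]
          exact hM.le
        have h3 : q * μ (G ∩ B) ≤ q * ((2 * D)⁻¹ * μ B) := by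
          refine h1.trans ((mul_le_mul_left h2 _).trans_eq (by ring))
        exact (ENNReal.mul_le_mul_iff_right hq0 ENNReal.coe_ne_top).1 h3
    have h2 : (2 * D)⁻¹ * D * μ U < μ G := by
      have hD' : D ≠ 0 := (zero_lt_one.trans_le h.one_le).ne'
      have : (2 * D)⁻¹ * D = 2⁻¹ := by
        rw [ENNReal.mul_inv (by simp) (by simp), mul_assoc, ENNReal.inv_mul_cancel hD' h.ne_top,
          mul_one]
      rw [this]
      calc (2 : ℝ≥0∞)⁻¹ * μ U < 2⁻¹ * (2 * μ G) := by
            rwa [ENNReal.mul_lt_mul_iff_right (by simp) (by simp)]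
        _ = μ G := by rw [← mul_assoc, ENNReal.inv_mul_cancel (by simp) (by simp), one_mul]
    exact absurd hle (not_le.2 h2)
  rw [ae_iff]
  refine measure_mono_null (t := ⋃ (q : ℚ) (n : ℕ),
    {x | 2 * D * ballMaximal d μ w x < (q : ℝ).toNNReal ∧ (q : ℝ).toNNReal < w x} ∩
      qball d c (n + 1)) (fun x hx => ?_)
    (measure_iUnion_null fun q => measure_iUnion_null fun n => key _ n)
  obtain ⟨q, -, hq⟩ := ENNReal.lt_iff_exists_rat_btwn.1 (not_le.1 hx)
  obtain ⟨n, hn⟩ := Set.mem_iUnion.1 (hc (Set.mem_univ x))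
  exact Set.mem_iUnion₂.2 ⟨q, n, hq, hn⟩

/-- The reverse weak-type inequality on a ball, for heights that exceed the maximal function at
some point of it. -/
theorem setLIntegral_lt_ballMaximal_le [BorelSpace Ω] (h : HasEnlargement d μ K D)
    {w : Ω → ℝ≥0∞} {x₀ c : Ω} {R : ℝ} (hx₀ : x₀ ∈ qball d c R)
    {a : ℝ≥0∞} (ha : D * ballMaximal d μ w x₀ ≤ a) :
    ∫⁻ y in qball d c R ∩ {x | a < ballMaximal d μ w x}, w y ∂μ ≤
      a * D * μ (qball d c (K * R) ∩ {x | a < ballMaximal d μ w x}) := by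
  set S := qball d c R ∩ {x | a < ballMaximal d μ w x}
  set good : Ω → Ω → ℝ → Prop := fun x c' r => 0 < r ∧ x ∈ qball d c' r ∧
    a * μ (qball d c' r) < ∫⁻ y in qball d c' r, w y ∂μ
  have hD' : D ≠ 0 := (zero_lt_one.trans_le h.one_le).ne'
  have hK := h.two_le
  -- A good ball of radius at least R would have x₀ in its enlargement, so its average would be at
  -- most D · Mw(x₀) ≤ a.
  have hsmall : ∀ x ∈ S, ∀ c' r, good x c' r → r < R := by
    rintro x hx c' r ⟨hr, hxr, hlt⟩
    by_contra! hRr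
    have hsub : qball d c R ⊆ qball d c' (K * r) :=
      h.subset _ _ _ _ (by linarith) ⟨x, hx.1, hxr⟩
    refine absurd hlt (not_lt.2 ?_)
    calc ∫⁻ y in qball d c' r, w y ∂μ ≤ ∫⁻ y in qball d c' (K * r), w y ∂μ :=
          lintegral_mono_set (qball_mono (by nlinarith))
      _ ≤ ballMaximal d μ w x₀ * μ (qball d c' (K * r)) :=
          lintegral_ball_le_ballMaximal_mul h w (by positivity) (hsub hx₀)
      _ ≤ ballMaximal d μ w x₀ * (D * μ (qball d c' r)) := by gcongr; exact h.measure_le _ _ hr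
      _ = D * ballMaximal d μ w x₀ * μ (qball d c' r) := by ring
      _ ≤ _ := by gcongr
  -- A good ball whose radius exceeds half the supremum: since K ≥ 2, its enlargement is no longer
  -- good, which supplies the local bound for the covering lemma.
  have hex : ∀ x ∈ S, ∃ c' r, good x c' r ∧ ∀ c'' r', 2 * r ≤ r' → ¬ good x c'' r' := by
    intro x hx
    set T := {r : ℝ | ∃ c', good x c' r}
    obtain ⟨c₁, r₁, h₁⟩ := (lt_ballMaximal_iff h).1 hx.2
    have hTb : BddAbove T := ⟨R, fun r ⟨c', hr⟩ => (hsmall x hx c' r hr).le⟩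
    have hpos : 0 < sSup T := lt_of_lt_of_le h₁.1 (le_csSup hTb ⟨c₁, h₁⟩)
    obtain ⟨r, ⟨c', hr⟩, hlt⟩ := exists_lt_of_lt_csSup (s := T) ⟨r₁, c₁, h₁⟩ (half_lt_self hpos)
    exact ⟨c', r, hr, fun c'' r' hrr' hg => absurd (le_csSup hTb ⟨c'', hg⟩) (by linarith)⟩
  have := h.sigmaFinite
  rw [← withDensity_apply' w S]
  refine measure_le_of_covering h (R := R)
    (t := {p | ∃ x ∈ S, good x p.1 p.2 ∧ ∀ c'' r', 2 * p.2 ≤ r' → ¬ good x c'' r'})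
    (fun p ⟨_, _, hg, _⟩ => hg.1) (fun p ⟨x, hx, hg, _⟩ => (hsmall x hx _ _ hg).le)
    (fun x hx => ?_) (fun p ⟨x, hx, hg, _⟩ z hz => ?_) (fun p ⟨x, hx, hg, hmax⟩ => ?_)
  · obtain ⟨c', r, hg, hmax⟩ := hex x hx
    exact Set.mem_biUnion (x := (c', r)) ⟨x, hx, hg, hmax⟩ hg.2.1
  · have hlt := hsmall x hx _ _ hg
    exact ⟨h.subset _ _ _ _ (by linarith [hg.1]) ⟨x, hg.2.1, hx.1⟩ hz,
      (lt_ballMaximal_iff h).2 ⟨_, _, hg.1, hz, hg.2.2⟩⟩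
  · have hr := hg.1
    have hx' : x ∈ qball d p.1 (K * p.2) := qball_mono (by nlinarith) hg.2.1
    refine (measure_mono Set.inter_subset_right).trans ?_
    rw [withDensity_apply' w]
    by_contra! hlt
    exact hmax p.1 (K * p.2) (by nlinarith) ⟨by positivity, hx', hlt⟩

end Covering


/-! ### Layer-cake integration and self-improvement of A₁ weights. -/

/-- Multiply the level estimate by δ t^(δ-1) and integrate in t. The extra factor t raises the
exponent on the right to 1 + δ; levels below a contribute at most a^δ times the total mass. -/
theorem lintegral_rpow_le_of_measure_lt_le {α : Type*} [MeasurableSpace α] {ν ρ : Measure α}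
    {f : α → ℝ} (hf : Measurable f) (hf0 : ∀ x, 0 ≤ f x) {a δ : ℝ} (ha : 0 ≤ a) (hδ : 0 < δ)
    {D : ℝ≥0∞} (hD : D ≠ ∞)
    (h : ∀ t, a ≤ t → ν {x | t < f x} ≤ ENNReal.ofReal t * D * ρ {x | t < f x}) :
    ∫⁻ x, ENNReal.ofReal (f x ^ δ) ∂ν ≤ ENNReal.ofReal (a ^ δ) * ν Set.univ +
      D * ENNReal.ofReal δ * ∫⁻ x, ENNReal.ofReal (f x ^ (1 + δ)) ∂ρ := by
  have hδ1 : 0 < 1 + δ := by positivity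
  have hconst : ENNReal.ofReal (a ^ δ) * ν Set.univ = ENNReal.ofReal δ *
      ∫⁻ t in Set.Ioi 0, ν {_x : α | t < a} * ENNReal.ofReal (t ^ (δ - 1)) := by
    rw [← lintegral_rpow_eq_lintegral_meas_lt_mul ν (f := fun _ => a) (ae_of_all _ fun _ => ha)
      aemeasurable_const hδ, lintegral_const]
  rw [lintegral_rpow_eq_lintegral_meas_lt_mul ν (ae_of_all _ hf0) hf.aemeasurable hδ,
    lintegral_rpow_eq_lintegral_meas_lt_mul ρ (ae_of_all _ hf0) hf.aemeasurable hδ1, hconst]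
  set I := ∫⁻ t in Set.Ioi 0, ρ {x | t < f x} * ENNReal.ofReal (t ^ (1 + δ - 1))
  have hanti : Antitone fun t : ℝ => ν {_x : α | t < a} := fun s t hst =>
    measure_mono fun x hx => lt_of_le_of_lt hst hx
  calc _ ≤ ENNReal.ofReal δ * ∫⁻ t in Set.Ioi 0,
          (ν {_x : α | t < a} * ENNReal.ofReal (t ^ (δ - 1)) +
            D * (ρ {x | t < f x} * ENNReal.ofReal (t ^ (1 + δ - 1)))) := by
        gcongr ENNReal.ofReal δ * ?_
        refine setLIntegral_mono' measurableSet_Ioi fun t (ht : 0 < t) => ?_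
        rcases lt_or_ge t a with hta | hta
        · refine le_trans ?_ le_self_add
          gcongr ?_ * _
          exact measure_mono fun x _ => hta
        · refine le_trans ?_ le_add_self
          refine (mul_le_mul_left (h t hta) _).trans_eq ?_
          have : ENNReal.ofReal (t ^ (1 + δ - 1)) =
              ENNReal.ofReal t * ENNReal.ofReal (t ^ (δ - 1)) := by
            rw [← ENNReal.ofReal_mul ht.le, add_sub_assoc, Real.rpow_add ht, Real.rpow_one]
          rw [this]
          ring
    _ = ENNReal.ofReal δ *
          (∫⁻ t in Set.Ioi 0, ν {_x : α | t < a} * ENNReal.ofReal (t ^ (δ - 1))) +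
          D * ENNReal.ofReal δ * I := by
        rw [lintegral_add_left (f := fun t => ν {_x : α | t < a} * ENNReal.ofReal (t ^ (δ - 1)))
          (hanti.measurable.mul (by fun_prop)), lintegral_const_mul' _ _ hD]
        ring
    _ ≤ _ := by
        gcongr
        -- The layer-cake formula at exponent 1 + δ carries the factor 1 + δ ≥ 1, which is given
        -- away.
        refine le_mul_of_one_le_left zero_le ?_
        rw [ENNReal.one_le_ofReal]
        linarith

section ReverseHolder

variable {Ω : Type*} [TopologicalSpace Ω] [MeasurableSpace Ω] [BorelSpace Ω] {d : Ω → Ω → ℝ}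
  {μ : Measure Ω} {K : ℝ} {D : ℝ≥0∞}

/-- The reverse weak-type inequality integrated over levels, with ν = w dμ on the ball, ρ = μ on its
enlargement, and D · Mw(x₀) as the lowest level. The factor δ in front of the last integral is what
later makes it absorbable. -/
theorem setLIntegral_mul_rpow_le (h : HasEnlargement d μ K D) {w : Ω → ℝ≥0∞}
    (hw : Measurable w) (hfin : ∀ x, ballMaximal d μ w x ≠ ∞) {x₀ c : Ω} {R δ : ℝ}
    (hx₀ : x₀ ∈ qball d c R) (hδ : 0 < δ) :
    ∫⁻ y in qball d c R, w y * ballMaximal d μ w y ^ δ ∂μ ≤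
      (D * ballMaximal d μ w x₀) ^ δ * ∫⁻ y in qball d c R, w y ∂μ +
      D * ENNReal.ofReal δ * ∫⁻ y in qball d c (K * R), ballMaximal d μ w y ^ (1 + δ) ∂μ := by
  set F := ballMaximal d μ w
  have hF : Measurable F := measurable_ballMaximal h w
  have := h.sigmaFinite
  have hDF : D * F x₀ ≠ ∞ := ENNReal.mul_ne_top h.ne_top (hfin x₀)
  have hrp : ∀ (p : ℝ), 0 < p → ∀ x, ENNReal.ofReal ((F x).toReal ^ p) = F x ^ p := by
    intro p hp x
    rw [← ENNReal.ofReal_rpow_of_nonneg ENNReal.toReal_nonneg hp.le, ENNReal.ofReal_toReal (hfin x)]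
  have key := lintegral_rpow_le_of_measure_lt_le (ν := (μ.withDensity w).restrict (qball d c R))
    (ρ := μ.restrict (qball d c (K * R))) (f := fun x => (F x).toReal) hF.ennreal_toReal
    (fun x => ENNReal.toReal_nonneg) (a := (D * F x₀).toReal) ENNReal.toReal_nonneg hδ h.ne_top
    (fun t ht => by
      have ht0 : 0 ≤ t := ENNReal.toReal_nonneg.trans ht
      have hset : {x | t < (F x).toReal} = {x | ENNReal.ofReal t < F x} := by
        ext x
        exact (ENNReal.ofReal_lt_iff_lt_toReal ht0 (hfin x)).symm
      have hm : MeasurableSet {x | ENNReal.ofReal t < F x} := measurableSet_lt measurable_const hF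
      rw [hset, Measure.restrict_apply hm, Measure.restrict_apply hm, withDensity_apply' w,
        Set.inter_comm, Set.inter_comm _ (qball d c (K * R))]
      exact setLIntegral_lt_ballMaximal_le h hx₀
        ((ENNReal.le_ofReal_iff_toReal_le hDF ht0).2 ht))
  simp only [hrp _ hδ, hrp _ (show 0 < 1 + δ by positivity)] at key
  rw [← ENNReal.ofReal_rpow_of_nonneg ENNReal.toReal_nonneg hδ.le, ENNReal.ofReal_toReal hDF,
    Measure.restrict_apply_univ, withDensity_apply' w, restrict_withDensity' _,
    lintegral_withDensity_eq_lintegral_mul _ hw (hF.pow_const δ)] at key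
  exact key

/-- The A₁ condition turns (Mw)^(1+δ) into C w (Mw)^δ, so the average over a ball is bounded by a
term independent of the ball plus half the average over its enlargement. Taking the supremum over
all larger concentric balls absorbs the second term; boundedness of w serves to make this supremum
finite. -/
theorem ballMaximal_mul_rpow_le (h : HasEnlargement d μ K D) {w : Ω → ℝ≥0∞} (hw : Measurable w)
    {N : ℝ≥0∞} (hN : N ≠ ∞) (hwN : ∀ x, w x ≤ N) {C : ℝ≥0∞} (hC : C ≠ ∞)
    (hA1 : ∀ᵐ x ∂μ, ballMaximal d μ w x ≤ C * w x) {δ : ℝ} (hδ : 0 < δ)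
    (hsmall : 2 * D * D * ENNReal.ofReal δ * C ≤ 1) (x : Ω) :
    ballMaximal d μ (fun y => w y * ballMaximal d μ w y ^ δ) x ≤
      2 * (D * ballMaximal d μ w x) ^ (1 + δ) := by
  set F := ballMaximal d μ w
  have hFN : ∀ x, F x ≤ N := fun x => ballMaximal_le h fun c r _ _ =>
    (lintegral_mono fun y => hwN y).trans_eq (by simp)
  set G : Ω → ℝ≥0∞ := fun y => w y * F y ^ δ
  have hGN : ∀ y, G y ≤ N * N ^ δ := fun y =>
    mul_le_mul' (hwN y) (ENNReal.rpow_le_rpow (hFN y) hδ.le)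
  have hD := h.ne_top
  refine iSup_le fun c => iSup_le fun r => iSup_le fun hr => iSup_le fun hx => ?_
  set A : ℝ → ℝ≥0∞ := fun s => (∫⁻ y in qball d c s, G y ∂μ) / μ (qball d c s)
  have hstep : ∀ s, r ≤ s → A s ≤ (D * F x) ^ (1 + δ) + 2⁻¹ * A (K * s) := by
    intro s hs
    have hs0 : 0 < s := hr.trans_le hs
    have hKs : 0 < K * s := mul_pos (by linarith [h.two_le]) hs0
    have hxs : x ∈ qball d c s := qball_mono hs hx
    have h1 := setLIntegral_mul_rpow_le h hw (fun y => ((hFN y).trans_lt hN.lt_top).ne) hxs hδ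
    refine (ENNReal.div_le_iff_le_mul (Or.inl (h.pos c s hs0).ne')
      (Or.inl (h.lt_top c s).ne)).2 (h1.trans ?_)
    rw [add_mul]
    gcongr ?_ + ?_
    · calc _ ≤ (D * F x) ^ δ * (F x * μ (qball d c s)) := by
            gcongr; exact lintegral_ball_le_ballMaximal_mul h w hs0 hxs
        _ ≤ (D * F x) ^ δ * ((D * F x) * μ (qball d c s)) := by
            gcongr; exact le_mul_of_one_le_left zero_le h.one_le
        _ = _ := by
            rw [← mul_assoc, ENNReal.rpow_add_of_nonneg _ _ zero_le_one hδ.le, ENNReal.rpow_one,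
              mul_comm (D * F x)]
    · have h2 : ∫⁻ y in qball d c (K * s), F y ^ (1 + δ) ∂μ ≤
          C * ∫⁻ y in qball d c (K * s), G y ∂μ := by
        rw [← lintegral_const_mul' _ _ hC]
        refine lintegral_mono_ae (ae_restrict_of_ae (hA1.mono fun y hy => ?_))
        rw [ENNReal.rpow_add_of_nonneg _ _ zero_le_one hδ.le, ENNReal.rpow_one, ← mul_assoc]
        gcongr
      have h3 : ∫⁻ y in qball d c (K * s), G y ∂μ ≤ A (K * s) * (D * μ (qball d c s)) := by
        refine (ENNReal.div_mul_cancel (h.pos c _ hKs).ne' (h.lt_top c (K * s)).ne).symm.trans_le ?_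
        gcongr
        exact h.measure_le c s hs0
      have h4 : D * D * ENNReal.ofReal δ * C ≤ 2⁻¹ := by
        rw [← one_div, ENNReal.le_div_iff_mul_le (by simp) (by simp)]
        exact hsmall.trans_eq' (by ring)
      calc _ ≤ D * ENNReal.ofReal δ * (C * (A (K * s) * (D * μ (qball d c s)))) := by
            gcongr; exact h2.trans (by gcongr)
        _ = (D * D * ENNReal.ofReal δ * C) * A (K * s) * μ (qball d c s) := by ring
        _ ≤ _ := by gcongr
  set T := ⨆ s : Set.Ici r, A s
  have hT : T ≤ (D * F x) ^ (1 + δ) + 2⁻¹ * T := iSup_le fun ⟨s, hs⟩ => by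
    have hs' : r ≤ K * s := by
      have : r ≤ s := hs
      nlinarith [h.two_le]
    refine (hstep s hs).trans ?_
    gcongr
    exact le_iSup (fun s : Set.Ici r => A s) ⟨K * s, hs'⟩
  have hTtop : T ≠ ∞ := by
    refine ((iSup_le fun ⟨s, hs⟩ => ?_ : T ≤ N * N ^ δ).trans_lt ?_).ne
    · have hs0 : 0 < s := hr.trans_le hs
      refine (ENNReal.div_le_iff_le_mul (Or.inl (h.pos c s hs0).ne')
        (Or.inl (h.lt_top c s).ne)).2 ((lintegral_mono fun y => hGN y).trans_eq (by simp))
    · exact ENNReal.mul_lt_top hN.lt_top (ENNReal.rpow_lt_top_of_nonneg hδ.le hN)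
  have hfin : T ≤ 2 * (D * F x) ^ (1 + δ) := by
    have e : T = 2⁻¹ * T + 2⁻¹ * T := by rw [← add_mul, ENNReal.inv_two_add_inv_two, one_mul]
    have hle : 2⁻¹ * T ≤ (D * F x) ^ (1 + δ) := by
      refine (ENNReal.add_le_add_iff_right (a := 2⁻¹ * T) (by finiteness)).1 ?_
      rwa [← e]
    calc T = 2 * (2⁻¹ * T) := by
          rw [← mul_assoc, ENNReal.mul_inv_cancel (by simp) (by simp), one_mul]
      _ ≤ _ := by gcongr
  exact (le_iSup (fun s : Set.Ici r => A s) ⟨r, le_refl r⟩).trans hfin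

/-- The sharp self-improvement of the `A₁` condition: the gain in the exponent is inversely
proportional to the constant of the weight. -/
theorem ballMaximal_rpow_le (h : HasEnlargement d μ K D) {w : Ω → ℝ≥0∞} (hw : AEMeasurable w μ)
    {C : ℝ≥0∞} (hC1 : 1 ≤ C) (hC : C ≠ ∞)
    (hA1 : ∀ᵐ x ∂μ, ballMaximal d μ w x ≤ C * w x) {δ : ℝ} (hδ : 0 < δ) (hδ1 : δ ≤ 1)
    (hsmall : 2 * D * D * ENNReal.ofReal δ * C ≤ 1) (x : Ω) :
    ballMaximal d μ (fun y => w y ^ (1 + δ)) x ≤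
      2 * D * (2 * (D * ballMaximal d μ w x) ^ (1 + δ)) := by
  wlog hwm : Measurable w generalizing w
  · have hle := this hw.measurable_mk.aemeasurable (by
      filter_upwards [hA1, hw.ae_eq_mk] with y h1 h2
      rw [← h2]
      exact (ballMaximal_mono_ae hw.ae_eq_mk.symm.le y).trans h1) hw.measurable_mk
    refine (ballMaximal_mono_ae (hw.ae_eq_mk.mono fun y hy => ?_) x).trans (hle.trans ?_)
    · exact (congrArg (· ^ (1 + δ)) hy).le
    · gcongr
      exact ballMaximal_mono_ae hw.ae_eq_mk.symm.le x
  have hp : 0 < 1 + δ := by positivity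
  -- Truncations are bounded and, as C ≥ 1, keep the A₁ constant C; monotone convergence on each
  -- ball then removes the truncation.
  have htrunc : ∀ n : ℕ, ballMaximal d μ (fun y => min (w y) n ^ (1 + δ)) x ≤
      2 * D * (2 * (D * ballMaximal d μ w x) ^ (1 + δ)) := by
    intro n
    set v : Ω → ℝ≥0∞ := fun y => min (w y) n
    have hv : Measurable v := hwm.min measurable_const
    have hvw : ∀ y, ballMaximal d μ v y ≤ ballMaximal d μ w y := fun y =>
      ballMaximal_mono_ae (ae_of_all _ fun z => min_le_left _ _) y
    have hvn : ∀ y, ballMaximal d μ v y ≤ n := fun y => ballMaximal_le h fun c r _ _ =>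
      (lintegral_mono fun z => min_le_right (w z) (n : ℝ≥0∞)).trans_eq (by simp)
    have hvA1 : ∀ᵐ y ∂μ, ballMaximal d μ v y ≤ C * v y := by
      filter_upwards [hA1] with y hy
      rcases min_choice (w y) (n : ℝ≥0∞) with e | e <;> simp only [v, e]
      · exact (hvw y).trans hy
      · exact (hvn y).trans (le_mul_of_one_le_left zero_le hC1)
    have h2D : 1 ≤ 2 * D := by
      calc (1 : ℝ≥0∞) = 1 * 1 := by simp
        _ ≤ 2 * D := mul_le_mul' (by norm_num) h.one_le
    -- The absorption estimate concerns v (Mv)^δ, which dominates v^(1+δ) up to the factor (2D)^δ ≤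
    -- 2D.
    have hpt : ∀ᵐ y ∂μ, v y ^ (1 + δ) ≤ 2 * D * (v y * ballMaximal d μ v y ^ δ) := by
      filter_upwards [ae_le_ballMaximal h hv.aemeasurable] with y hy
      rw [ENNReal.rpow_add_of_nonneg _ _ zero_le_one hδ.le, ENNReal.rpow_one]
      calc v y * v y ^ δ ≤ v y * (2 * D * ballMaximal d μ v y) ^ δ := by gcongr
        _ = v y * ((2 * D) ^ δ * ballMaximal d μ v y ^ δ) := by
            rw [ENNReal.mul_rpow_of_nonneg _ _ hδ.le]
        _ ≤ v y * ((2 * D) ^ (1 : ℝ) * ballMaximal d μ v y ^ δ) := by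
            exact mul_le_mul' le_rfl
              (mul_le_mul' (ENNReal.rpow_le_rpow_of_exponent_le h2D hδ1) le_rfl)
        _ = _ := by rw [ENNReal.rpow_one]; ring
    refine (ballMaximal_mono_ae hpt x).trans ((ballMaximal_const_mul_le h
      (by have := h.ne_top; finiteness) _ x).trans ?_)
    gcongr
    refine (ballMaximal_mul_rpow_le h hv (ENNReal.natCast_ne_top n) (fun y => min_le_right _ _) hC
      hvA1 hδ hsmall x).trans ?_
    gcongr
    exact hvw x
  refine ballMaximal_le h fun c r hr hx => ?_
  refine le_of_tendsto' (lintegral_tendsto_of_tendsto_of_monotone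
    (f := fun (n : ℕ) y => min (w y) n ^ (1 + δ)) (fun n => by fun_prop) (ae_of_all _ fun y => ?_)
    (ae_of_all _ fun y => ?_))
    fun n => (lintegral_ball_le_ballMaximal_mul h _ hr hx).trans (by gcongr; exact htrunc n)
  · intro m n hmn
    have : (m : ℝ≥0∞) ≤ n := by exact_mod_cast hmn
    dsimp only
    gcongr
  · have h1 : Tendsto (fun n : ℕ => min (w y) n) atTop (𝓝 (min (w y) ∞)) :=
      tendsto_const_nhds.min ENNReal.tendsto_nat_nhds_top
    rw [min_eq_left le_top] at h1
    exact (ENNReal.continuous_rpow_const.tendsto _).comp h1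

omit [BorelSpace Ω] in
/-- Jensen's inequality for the maximal function. -/
theorem ballMaximal_rpow_le_ballMaximal_rpow (h : HasEnlargement d μ K D) {w : Ω → ℝ≥0∞}
    (hw : AEMeasurable w μ) {t : ℝ} (ht : 1 ≤ t) (x : Ω) :
    ballMaximal d μ w x ^ t ≤ ballMaximal d μ (fun y => w y ^ t) x := by
  have ht0 : 0 < t := by positivity
  rw [← ENNReal.le_rpow_inv_iff ht0]
  refine ballMaximal_le h fun c r hr hx => ?_
  have hH := eLpNorm'_le_eLpNorm'_mul_rpow_measure_univ (μ := μ.restrict (qball d c r)) one_pos ht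
    hw.restrict.aestronglyMeasurable
  simp only [eLpNorm', enorm_eq_self, ENNReal.rpow_one, div_one, Measure.restrict_apply_univ,
    one_div] at hH
  refine hH.trans ?_
  calc _ ≤ (ballMaximal d μ (fun y => w y ^ t) x * μ (qball d c r)) ^ t⁻¹ *
        μ (qball d c r) ^ (1 - t⁻¹) := by
        gcongr; exact lintegral_ball_le_ballMaximal_mul h _ hr hx
    _ = _ := by
        rw [ENNReal.mul_rpow_of_nonneg _ _ (by positivity), mul_assoc,
          ← ENNReal.rpow_add_of_nonneg _ _ (by positivity)
            (by simpa using inv_le_one_of_one_le₀ ht), add_sub_cancel, ENNReal.rpow_one]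

end ReverseHolder


/-! ### Solidity and series in a quasi-Banach lattice. -/

namespace FunctionSpace

variable {Ω : Type*} [MeasurableSpace Ω] {μ : Measure Ω} {X : FunctionSpace μ}

theorem IsQuasiNormedLattice.mem_of_enorm_le (hX : X.IsQuasiNormedLattice) {g h : Ω →ₘ[μ] ℂ}
    (hh : h ∈ X.carrier) (hgh : ∀ᵐ x ∂μ, ‖g x‖ₑ ≤ ‖h x‖ₑ) :
    g ∈ X.carrier ∧ X.qnorm g ≤ X.qnorm h :=
  hX.lattice h hh g (hgh.mono fun _ hx => enorm_le_iff_norm_le.1 hx)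

theorem enorm_absPow (f : Ω →ₘ[μ] ℂ) {r : ℝ} (hr : 0 < r) :
    ∀ᵐ x ∂μ, ‖absPow f r x‖ₑ = ‖f x‖ₑ ^ r := by
  filter_upwards [AEEqFun.coeFn_mk (fun x => ((‖f x‖ ^ r : ℝ) : ℂ))
    (Complex.measurable_ofReal.comp_aemeasurable
      (f.aestronglyMeasurable.norm.aemeasurable.pow_const r)).aestronglyMeasurable] with x hx
  rw [absPow, hx, ← ofReal_norm, ← ofReal_norm, Complex.norm_real, Real.norm_of_nonneg
    (by positivity), ENNReal.ofReal_rpow_of_nonneg (norm_nonneg _) hr.le]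

theorem mem_of_enorm_ae_eq (hX : X.IsQuasiNormedLattice) {g h : Ω →ₘ[μ] ℂ}
    (hgh : ∀ᵐ x ∂μ, ‖g x‖ₑ = ‖h x‖ₑ) (hh : h ∈ X.carrier) :
    g ∈ X.carrier ∧ X.qnorm g = X.qnorm h := by
  obtain ⟨h1, h2⟩ := hX.mem_of_enorm_le hh (hgh.mono fun _ hx => hx.le)
  exact ⟨h1, h2.antisymm (hX.mem_of_enorm_le h1 (hgh.mono fun _ hx => hx.ge)).2⟩

theorem exists_enorm_eq {v : Ω → ℝ≥0∞} (hv : AEMeasurable v μ) (hfin : ∀ᵐ x ∂μ, v x < ∞) :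
    ∃ g : Ω →ₘ[μ] ℂ, ∀ᵐ x ∂μ, ‖g x‖ₑ = v x ∧ g x = ((v x).toReal : ℂ) := by
  have hm : AEStronglyMeasurable (fun x => ((v x).toReal : ℂ)) μ :=
    (Complex.measurable_ofReal.comp_aemeasurable hv.ennreal_toReal).aestronglyMeasurable
  refine ⟨AEEqFun.mk _ hm, ?_⟩
  filter_upwards [AEEqFun.coeFn_mk _ hm, hfin] with x hx hlt
  refine ⟨?_, hx⟩
  rw [hx, ← ofReal_norm, Complex.norm_real, Real.norm_of_nonneg ENNReal.toReal_nonneg,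
    ENNReal.ofReal_toReal hlt.ne]

/-- The ratio 1/(2C) beats the loss of a factor C at every use of the quasi-triangle inequality:
splitting off one term reproduces the tail bound 2CE(2C)⁻ᵐ exactly. The sum of the series of moduli
is therefore a limit in X. -/
theorem IsQuasiBanachLattice.exists_tsum_le (hX : X.IsQuasiBanachLattice) {C : ℝ} (hC : 1 ≤ C)
    (htri : ∀ f ∈ X.carrier, ∀ g ∈ X.carrier, X.qnorm (f + g) ≤ C * (X.qnorm f + X.qnorm g))
    {a : ℕ → Ω →ₘ[μ] ℂ} (ha : ∀ k, a k ∈ X.carrier) {E : ℝ} (hE : 0 ≤ E)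
    (hbound : ∀ k, X.qnorm (a k) ≤ E * ((2 * C)⁻¹) ^ k) :
    ∃ H ∈ X.carrier, (∀ᵐ x ∂μ, ∑' k, ‖a k x‖ₑ ≤ ‖H x‖ₑ) ∧ X.qnorm H ≤ 2 * C ^ 2 * E := by
  have hX' := hX.toIsQuasiNormedLattice
  have hC0 : 0 < C := by positivity
  choose b hb using fun k => exists_enorm_eq (μ := μ) (v := fun x => ‖a k x‖ₑ)
    (a k).aestronglyMeasurable.enorm (ae_of_all _ fun x => enorm_lt_top)
  have hbX : ∀ k, b k ∈ X.carrier ∧ X.qnorm (b k) = X.qnorm (a k) := fun k =>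
    mem_of_enorm_ae_eq hX' ((hb k).mono fun _ hx => hx.1) (ha k)
  have htail : ∀ p m, ∑ j ∈ Finset.range p, b (m + j) ∈ X.carrier ∧
      X.qnorm (∑ j ∈ Finset.range p, b (m + j)) ≤ 2 * C * E * ((2 * C)⁻¹) ^ m := by
    intro p
    induction p with
    | zero =>
      intro m
      simp only [Finset.range_zero, Finset.sum_empty, (hX.eq_zero_iff 0 hX.zero_mem).2 rfl]
      exact ⟨hX.zero_mem, by positivity⟩
    | succ p ih =>
      intro m
      have e : ∑ j ∈ Finset.range (p + 1), b (m + j) =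
          b m + ∑ j ∈ Finset.range p, b (m + 1 + j) := by
        rw [Finset.sum_range_succ', add_comm]
        simp [add_assoc, add_comm 1]
      rw [e]
      refine ⟨hX.add_mem _ (hbX m).1 _ (ih (m + 1)).1, ?_⟩
      refine (htri _ (hbX m).1 _ (ih (m + 1)).1).trans ?_
      calc _ ≤ C * (E * ((2 * C)⁻¹) ^ m + 2 * C * E * ((2 * C)⁻¹) ^ (m + 1)) := by
            gcongr
            · rw [(hbX m).2]; exact hbound m
            · exact (ih (m + 1)).2
        _ = _ := by rw [pow_succ]; field_simp; ring
  set S : ℕ → Ω →ₘ[μ] ℂ := fun n => ∑ k ∈ Finset.range n, b k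
  have hS : ∀ n, S n ∈ X.carrier ∧ X.qnorm (S n) ≤ 2 * C * E := fun n => by
    simpa using htail n 0
  have hneg : ∀ f g, f - g ∈ X.carrier → g - f ∈ X.carrier ∧ X.qnorm (g - f) = X.qnorm (f - g) := by
    intro f g h
    have e : g - f = (-1 : ℂ) • (f - g) :=
      (neg_sub f g).symm.trans (neg_one_smul ℂ (f - g)).symm
    rw [e]
    exact ⟨hX.smul_mem _ _ h, by rw [hX.qnorm_smul _ _ h]; simp⟩
  have hdiff : ∀ n m, n ≤ m → S m - S n ∈ X.carrier ∧
      X.qnorm (S m - S n) ≤ 2 * C * E * ((2 * C)⁻¹) ^ n := by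
    intro n m hnm
    obtain ⟨p, rfl⟩ := Nat.exists_eq_add_of_le hnm
    simp only [S, Finset.sum_range_add, add_sub_cancel_left]
    exact htail p n
  have hgeom : Tendsto (fun n => 2 * C * E * ((2 * C)⁻¹) ^ n) atTop (𝓝 0) := by
    have := (tendsto_pow_atTop_nhds_zero_of_lt_one (r := (2 * C)⁻¹) (by positivity)
      (inv_lt_one_of_one_lt₀ (by linarith))).const_mul (2 * C * E)
    simpa using this
  obtain ⟨G, hG, hlim⟩ := hX.complete S (fun n => (hS n).1) (fun ε hε => by
    obtain ⟨N, hN⟩ := eventually_atTop.1 (hgeom.eventually (gt_mem_nhds hε))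
    refine ⟨N, fun m hm n hn => ?_⟩
    rcases le_total n m with h | h
    · exact (hdiff n m h).2.trans_lt (hN n hn)
    · rw [(hneg _ _ (hdiff m n h).1).2]
      exact (hdiff m n h).2.trans_lt (hN m hm))
  have hSG : ∀ n, S n - G ∈ X.carrier := fun n => by
    rw [sub_eq_add_neg, ← neg_one_smul ℂ]
    exact hX.add_mem _ (hS n).1 _ (hX.smul_mem _ _ hG)
  have hScoe : ∀ n, ∀ᵐ x ∂μ, ‖S n x‖ₑ = ∑ k ∈ Finset.range n, ‖a k x‖ₑ := by
    intro n
    have hsum : ∀ᵐ x ∂μ, S n x = ((∑ k ∈ Finset.range n, ‖a k x‖ : ℝ) : ℂ) := by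
      induction n with
      | zero => filter_upwards [AEEqFun.coeFn_zero (μ := μ) (β := ℂ)] with x hx; simpa [S] using hx
      | succ n ih =>
        have e : S (n + 1) = S n + b n := Finset.sum_range_succ _ _
        filter_upwards [ih, hb n, AEEqFun.coeFn_add (S n) (b n)] with x h1 h2 h3
        rw [e, h3, Pi.add_apply, h1, h2.2, Finset.sum_range_succ]
        simp
    filter_upwards [hsum] with x hx
    rw [hx, ← ofReal_norm, Complex.norm_real, Real.norm_of_nonneg (by positivity),
      ENNReal.ofReal_sum_of_nonneg (fun _ _ => norm_nonneg _)]
    simp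
  have hSle : ∀ n, ∀ᵐ x ∂μ, ‖S n x‖ₑ ≤ ‖G x‖ₑ := by
    intro n
    -- Domination by the limit without almost everywhere convergence: the positive part e of |Sₙ| -
    -- |G| is at most |Sₘ - G| for all m ≥ n, so its quasi-norm vanishes.
    obtain ⟨e, he⟩ := exists_enorm_eq (μ := μ) (v := fun x => ‖S n x‖ₑ - ‖G x‖ₑ)
      ((S n).aestronglyMeasurable.enorm.sub G.aestronglyMeasurable.enorm)
      (ae_of_all _ fun x => tsub_le_self.trans_lt enorm_lt_top)
    have hem : ∀ m, n ≤ m → e ∈ X.carrier ∧ X.qnorm e ≤ X.qnorm (S m - G) := by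
      intro m hnm
      refine hX'.mem_of_enorm_le (hSG m) ?_
      filter_upwards [he, hScoe n, hScoe m, AEEqFun.coeFn_sub (S m) G] with x h1 h2 h3 h4
      rw [h1.1, h4, Pi.sub_apply, tsub_le_iff_right]
      calc ‖S n x‖ₑ ≤ ‖S m x‖ₑ := by
            rw [h2, h3]
            exact Finset.sum_le_sum_of_subset (by simpa using hnm)
        _ = ‖(S m x - G x) + G x‖ₑ := by rw [sub_add_cancel]
        _ ≤ _ := enorm_add_le _ _
    have he0 : X.qnorm e ≤ 0 := ge_of_tendsto hlim
      (eventually_atTop.2 ⟨n, fun m hm => (hem m hm).2⟩)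
    have heX := (hem n le_rfl).1
    have : e = 0 := (hX.eq_zero_iff e heX).1 (he0.antisymm (hX.nonneg e heX))
    filter_upwards [he, AEEqFun.coeFn_zero (μ := μ) (β := ℂ)] with x h1 h2
    rw [this, h2] at h1
    exact tsub_eq_zero_iff_le.1 (by simpa using h1.1.symm)
  refine ⟨G, hG, ?_, ?_⟩
  · filter_upwards [ae_all_iff.2 hScoe, ae_all_iff.2 hSle] with x h1 h2
    rw [ENNReal.tsum_eq_iSup_nat]
    exact iSup_le fun n => (h1 n).symm.trans_le (h2 n)
  · have hle : ∀ n, X.qnorm G ≤ C * (X.qnorm (S n - G) + 2 * C * E) := by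
      intro n
      have e : G = (G - S n) + S n := (sub_add_cancel _ _).symm
      obtain ⟨h1, h2⟩ := hneg _ _ (hSG n)
      calc X.qnorm G = X.qnorm ((G - S n) + S n) := by rw [← e]
        _ ≤ C * (X.qnorm (G - S n) + X.qnorm (S n)) := htri _ h1 _ (hS n).1
        _ ≤ _ := by rw [h2]; gcongr; exact (hS n).2
    have := ge_of_tendsto' ((hlim.add_const (2 * C * E)).const_mul C) hle
    exact this.trans_eq (by ring)

/-! ### Boundedness on convexifications, expressed through majorants. -/

/-- Boundedness of the maximal operator on `X^{(r)}`, with the `r`-th power of its constant, expressed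
through majorants in `X`. -/
def MaximalMajorized (d : Ω → Ω → ℝ) (X : FunctionSpace μ) (C r : ℝ) : Prop :=
  ∀ g : Ω →ₘ[μ] ℂ, absPow g r ∈ X.carrier → ∃ h ∈ X.carrier,
    (∀ᵐ x ∂μ, maximalFunction d μ g x ^ r ≤ ‖h x‖ₑ) ∧ X.qnorm h ≤ C * X.qnorm (absPow g r)

theorem MaximalMajorized.mono {d : Ω → Ω → ℝ} {C C' r : ℝ} (hX : X.IsQuasiNormedLattice)
    (h : MaximalMajorized d X C r) (hC : C ≤ C') : MaximalMajorized d X C' r := fun g hg => by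
  obtain ⟨v, hv, hle, hq⟩ := h g hg
  exact ⟨v, hv, hle, hq.trans (mul_le_mul_of_nonneg_right hC (hX.nonneg _ hg))⟩

theorem _root_.IsMaximalClass.enorm_eq {d : Ω → Ω → ℝ} {f g : Ω →ₘ[μ] ℂ}
    (h : IsMaximalClass d f g) : ∀ᵐ x ∂μ, ‖g x‖ₑ = maximalFunction d μ f x := by
  filter_upwards [h] with x hx
  rw [hx.2, ← ofReal_norm, Complex.norm_real, Real.norm_of_nonneg ENNReal.toReal_nonneg,
    ENNReal.ofReal_toReal hx.1.ne]

theorem _root_.IsMaximalClass.unique {d : Ω → Ω → ℝ} {f g g' : Ω →ₘ[μ] ℂ}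
    (h : IsMaximalClass d f g) (h' : IsMaximalClass d f g') : g = g' := by
  refine AEEqFun.ext ?_
  filter_upwards [h, h'] with x hx hx'
  rw [hx.2, hx'.2]

theorem convexification_qnorm_zero (hX : X.IsQuasiNormedLattice) {r : ℝ} (hr : 0 < r) :
    (X.convexification r).qnorm 0 = 0 := by
  have : absPow (0 : Ω →ₘ[μ] ℂ) r = 0 := by
    refine AEEqFun.ext ?_
    filter_upwards [enorm_absPow (0 : Ω →ₘ[μ] ℂ) hr, AEEqFun.coeFn_zero (μ := μ) (β := ℂ)]
      with x h1 h2
    rw [h2] at h1 ⊢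
    simpa [hr] using h1
  simp [convexification, this, (hX.eq_zero_iff 0 hX.zero_mem).2 rfl, hr.ne']

/-- The supremum that defines the operator quasi-norm is a bound for the operator. -/
theorem _root_.MaximalBoundedOn.majorized_opNorm {d : Ω → Ω → ℝ} {r : ℝ}
    (hX : X.IsQuasiNormedLattice) (hr : 0 < r) (h : MaximalBoundedOn d (X.convexification r)) :
    0 ≤ maximalOpNorm d (X.convexification r) ∧
      MaximalMajorized d X (maximalOpNorm d (X.convexification r) ^ r) r := by
  obtain ⟨C, hC, hb⟩ := h
  set Y := X.convexification r
  have hY0 : ∀ f ∈ Y.carrier, 0 ≤ Y.qnorm f := fun f hf => Real.rpow_nonneg (hX.nonneg _ hf) _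
  have hN0 : 0 ≤ maximalOpNorm d Y := Real.sSup_nonneg (by
    rintro t ⟨f, hf, -, g, hg, -, rfl⟩
    exact div_nonneg (hY0 g hg) (hY0 f hf))
  refine ⟨hN0, fun f hf => ?_⟩
  obtain ⟨g, hg, hcl, hle⟩ := hb f hf
  have hbdd : BddAbove {t : ℝ | ∃ f ∈ Y.carrier, f ≠ 0 ∧ ∃ g ∈ Y.carrier,
      IsMaximalClass d f g ∧ t = Y.qnorm g / Y.qnorm f} := by
    refine ⟨C, ?_⟩
    rintro t ⟨f, hf, -, g, hg, hcl, rfl⟩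
    obtain ⟨g', hg', hcl', hle'⟩ := hb f hf
    rw [hcl.unique hcl']
    exact div_le_of_le_mul₀ (hY0 f hf) hC hle'
  have hN : Y.qnorm g ≤ maximalOpNorm d Y * Y.qnorm f := by
    -- The supremum says nothing about f of quasi-norm zero; there the given bound C already forces
    -- the image to have quasi-norm zero.
    rcases (hY0 f hf).eq_or_lt with h0 | h0
    · rw [← h0, mul_zero] at hle ⊢
      exact hle
    · have hne : f ≠ 0 := by
        rintro rfl
        rw [convexification_qnorm_zero hX hr] at h0
        exact h0.false
      rw [← div_le_iff₀ h0]
      exact le_csSup hbdd ⟨f, hf, hne, g, hg, hcl, rfl⟩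
  refine ⟨absPow g r, hg, ?_, ?_⟩
  · filter_upwards [hcl.enorm_eq, enorm_absPow g hr] with x h1 h2
    rw [h2, h1]
  · have hq := Real.rpow_le_rpow (hY0 g hg) hN hr.le
    rw [Real.mul_rpow hN0 (hY0 f hf)] at hq
    simpa only [Y, convexification, one_div, Real.rpow_inv_rpow (hX.nonneg _ hg) hr.ne',
      Real.rpow_inv_rpow (hX.nonneg _ hf) hr.ne'] using hq

section

variable [TopologicalSpace Ω] [BorelSpace Ω] {d : Ω → Ω → ℝ} {K : ℝ} {D : ℝ≥0∞}

theorem aemeasurable_maximalFunction (h : HasEnlargement d μ K D) (f : Ω →ₘ[μ] ℂ) :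
    AEMeasurable (maximalFunction d μ f) μ :=
  (measurable_ballMaximal h fun y => ‖f y‖ₑ).aemeasurable

/-- A majorant in X is finite almost everywhere, hence so is Mf, and solidity puts its r-th power in
X. -/
theorem MaximalMajorized.exists_class {C r : ℝ} (hd : HasEnlargement d μ K D)
    (hX : X.IsQuasiNormedLattice) (hr : 0 < r) (h : MaximalMajorized d X C r) {f : Ω →ₘ[μ] ℂ}
    (hf : absPow f r ∈ X.carrier) :
    ∃ g, IsMaximalClass d f g ∧ absPow g r ∈ X.carrier ∧
      X.qnorm (absPow g r) ≤ C * X.qnorm (absPow f r) := by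
  obtain ⟨v, hv, hle, hq⟩ := h f hf
  have hfin : ∀ᵐ x ∂μ, maximalFunction d μ f x < ∞ := by
    filter_upwards [hle] with x hx
    by_contra! htop
    rw [top_le_iff.1 htop, ENNReal.top_rpow_of_pos hr] at hx
    exact absurd hx (not_le.2 enorm_lt_top)
  obtain ⟨g, hg⟩ := exists_enorm_eq (aemeasurable_maximalFunction hd f) hfin
  have hgv := hX.mem_of_enorm_le (g := absPow g r) hv (by
    filter_upwards [hle, hg, enorm_absPow g hr] with x h1 h2 h3
    rwa [h3, h2.1])
  refine ⟨g, ?_, hgv.1, hgv.2.trans hq⟩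
  filter_upwards [hfin, hg] with x h1 h2
  exact ⟨h1, h2.2⟩

theorem MaximalMajorized.maximalBoundedOn {C r : ℝ} (hd : HasEnlargement d μ K D)
    (hX : X.IsQuasiNormedLattice) (hr : 0 < r) (hC : 0 ≤ C) (h : MaximalMajorized d X C r) :
    MaximalBoundedOn d (X.convexification r) ∧
      maximalOpNorm d (X.convexification r) ≤ C ^ (1 / r) := by
  have key : ∀ f ∈ (X.convexification r).carrier, ∃ g ∈ (X.convexification r).carrier,
      IsMaximalClass d f g ∧
        (X.convexification r).qnorm g ≤ C ^ (1 / r) * (X.convexification r).qnorm f := by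
    intro f hf
    obtain ⟨g, hcl, hg, hq⟩ := h.exists_class hd hX hr hf
    refine ⟨g, hg, hcl, ?_⟩
    simp only [convexification]
    rw [← Real.mul_rpow hC (hX.nonneg _ hf)]
    exact Real.rpow_le_rpow (hX.nonneg _ hg) hq (by positivity)
  refine ⟨⟨_, by positivity, key⟩, Real.sSup_le ?_ (by positivity)⟩
  rintro t ⟨f, hf, -, g, hg, hcl, rfl⟩
  obtain ⟨g', hg', hcl', hle'⟩ := key f hf
  rw [hcl.unique hcl']
  exact div_le_of_le_mul₀ (Real.rpow_nonneg (hX.nonneg _ hf) _) (by positivity) hle'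

omit [TopologicalSpace Ω] [BorelSpace Ω] in
theorem absPow_absPow_mem (hX : X.IsQuasiNormedLattice) {f : Ω →ₘ[μ] ℂ} {p q r : ℝ} (hp : 0 < p)
    (hq : 0 < q) (hr : 0 < r) (hpq : p * q = r) (hf : absPow f r ∈ X.carrier) :
    absPow (absPow f p) q ∈ X.carrier ∧ X.qnorm (absPow (absPow f p) q) = X.qnorm (absPow f r) := by
  refine mem_of_enorm_ae_eq hX ?_ hf
  filter_upwards [enorm_absPow f hp, enorm_absPow f hr, enorm_absPow (absPow f p) hq] with x h1 h2 h3
  rw [h3, h1, h2, ← ENNReal.rpow_mul, hpq]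

-- Apply the hypothesis to |g|^(r'/r), whose r-th power is |g|^r', and use Jensen's inequality. The
-- constant is unchanged because it is normalized as the r-th power of an operator bound.
omit [BorelSpace Ω] in
theorem MaximalMajorized.of_le {C r r' : ℝ} (hd : HasEnlargement d μ K D)
    (hX : X.IsQuasiNormedLattice) (hr : 0 < r) (hrr' : r ≤ r') (h : MaximalMajorized d X C r) :
    MaximalMajorized d X C r' := by
  intro g hg
  have ht : 1 ≤ r' / r := (one_le_div hr).2 hrr'
  have ht0 : 0 < r' / r := by positivity
  obtain ⟨hmem, hqn⟩ := absPow_absPow_mem hX ht0 hr (hr.trans_le hrr') (div_mul_cancel₀ _ hr.ne') hg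
  obtain ⟨v, hv, hle, hq⟩ := h _ hmem
  refine ⟨v, hv, ?_, hqn ▸ hq⟩
  filter_upwards [hle] with x hx
  refine le_trans ?_ hx
  calc maximalFunction d μ g x ^ r' = (maximalFunction d μ g x ^ (r' / r)) ^ r := by
        rw [← ENNReal.rpow_mul, div_mul_cancel₀ _ hr.ne']
    _ ≤ (ballMaximal d μ (fun y => ‖g y‖ₑ ^ (r' / r)) x) ^ r := by
        gcongr
        exact ballMaximal_rpow_le_ballMaximal_rpow hd g.aestronglyMeasurable.enorm ht x
    _ ≤ _ := by
        gcongr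
        exact ballMaximal_mono_ae ((enorm_absPow g ht0).mono fun _ hy => hy.ge) x

/-- X and X^(1) are not literally the same space, as `absPow f 1` is the class of |f|; solidity
identifies their members and quasi-norms. -/
theorem maximalBoundedOn_iff_majorized (hd : HasEnlargement d μ K D)
    (hX : X.IsQuasiNormedLattice) :
    MaximalBoundedOn d X ↔ ∃ C, 0 ≤ C ∧ MaximalMajorized d X C 1 := by
  have hone : ∀ f : Ω →ₘ[μ] ℂ, ∀ᵐ x ∂μ, ‖absPow f 1 x‖ₑ = ‖f x‖ₑ := fun f =>
    (enorm_absPow f one_pos).mono fun x hx => by rw [hx, ENNReal.rpow_one]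
  constructor
  · rintro ⟨C, hC, h⟩
    refine ⟨C, hC, fun f hf => ?_⟩
    obtain ⟨g, hg, hcl, hle⟩ := h _ hf
    refine ⟨g, hg, ?_, hle⟩
    filter_upwards [hcl.enorm_eq] with x hx
    rw [hx, ENNReal.rpow_one]
    exact ballMaximal_mono_ae ((hone f).mono fun _ hy => hy.ge) x
  · rintro ⟨C, hC, h⟩
    refine ⟨C, hC, fun f hf => ?_⟩
    obtain ⟨hf1, hqf⟩ := mem_of_enorm_ae_eq hX (hone f) hf
    obtain ⟨g, hcl, hg1, hq⟩ := h.exists_class hd hX one_pos hf1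
    obtain ⟨hg, hqg⟩ := mem_of_enorm_ae_eq hX ((hone g).mono fun _ hx => hx.symm) hg1
    exact ⟨g, hg, hcl, by rwa [hqg, ← hqf]⟩

/-! ### From an A₁ majorant to an exponent below one. -/

/-- The Rubio de Francia construction. -/
theorem MaximalMajorized.exists_weight {C s Q : ℝ} (hd : HasEnlargement d μ K D)
    (hX : X.IsQuasiBanachLattice) (hC : 1 ≤ C)
    (htri : ∀ f ∈ X.carrier, ∀ g ∈ X.carrier, X.qnorm (f + g) ≤ C * (X.qnorm f + X.qnorm g))
    (hs1 : 1 ≤ s) (hs2 : s ≤ 2) (hQ : 1 ≤ Q) (h : MaximalMajorized d X (Q ^ s) s)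
    {f : Ω →ₘ[μ] ℂ} (hf : absPow f s ∈ X.carrier) :
    ∃ w : Ω → ℝ≥0∞, AEMeasurable w μ ∧ (∀ x, ‖f x‖ₑ ≤ w x) ∧
      (∀ᵐ x ∂μ, ballMaximal d μ w x ≤ ENNReal.ofReal (4 * C * Q) * w x) ∧
      ∃ H ∈ X.carrier, (∀ᵐ x ∂μ, w x ^ s ≤ ‖H x‖ₑ) ∧
        X.qnorm H ≤ 2 * C ^ 2 * (4 * X.qnorm (absPow f s)) := by
  have hX' := hX.toIsQuasiNormedLattice
  have hs0 : 0 < s := by positivity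
  have hC0 : 0 < C := by positivity
  have hQ0 : 0 < Q := by positivity
  choose! T hTcl hTmem hTq using fun (g : Ω →ₘ[μ] ℂ) (hg : absPow g s ∈ X.carrier) =>
    h.exists_class hd hX' hs0 hg
  set F : ℕ → Ω →ₘ[μ] ℂ := fun k => T^[k] f
  have hFs : ∀ k, F (k + 1) = T (F k) := fun k => Function.iterate_succ_apply' T k f
  have hF : ∀ k, absPow (F k) s ∈ X.carrier ∧
      X.qnorm (absPow (F k) s) ≤ (Q ^ k) ^ s * X.qnorm (absPow f s) := by
    intro k
    induction k with
    | zero => exact ⟨hf, by simp [F]⟩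
    | succ k ih =>
      rw [hFs]
      refine ⟨hTmem _ ih.1, (hTq _ ih.1).trans ?_⟩
      rw [pow_succ, Real.mul_rpow (by positivity) hQ0.le, mul_comm (_ ^ s) (Q ^ s), mul_assoc]
      gcongr
      exact ih.2
  -- The weight is Σ Λ⁻ᵏ Mᵏf. In Λ, the factor Q offsets the growth of the iterates, 2C gives the
  -- decay required by `exists_tsum_le`, and the remaining 2 pays for comparing a sum with a
  -- supremum.
  set Λ : ℝ := 4 * C * Q
  have hΛ : 0 < Λ := by positivity
  set c : ℝ≥0∞ := ENNReal.ofReal Λ⁻¹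
  have hΛc : ENNReal.ofReal Λ * c = 1 := by
    rw [← ENNReal.ofReal_mul hΛ.le, mul_inv_cancel₀ hΛ.ne', ENNReal.ofReal_one]
  have hFm : ∀ k, AEMeasurable (fun x => ‖F k x‖ₑ) μ := fun k => (F k).aestronglyMeasurable.enorm
  set w : Ω → ℝ≥0∞ := fun x => ∑' k, c ^ k * ‖F k x‖ₑ
  refine ⟨w, AEMeasurable.tsum fun k => (hFm k).const_mul _, fun x => ?_, ?_, ?_⟩
  · simpa [F] using ENNReal.le_tsum (f := fun k => c ^ k * ‖F k x‖ₑ) 0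
  · have hcl : ∀ᵐ x ∂μ, ∀ k, ‖F (k + 1) x‖ₑ = ballMaximal d μ (fun y => ‖F k y‖ₑ) x :=
      ae_all_iff.2 fun k => by rw [hFs]; exact (hTcl _ (hF k).1).enorm_eq
    filter_upwards [hcl] with x hx
    calc ballMaximal d μ w x ≤ ∑' k, ballMaximal d μ (fun y => c ^ k * ‖F k y‖ₑ) x :=
          ballMaximal_tsum_le hd (fun k => (hFm k).const_mul _) x
      _ ≤ ∑' k, c ^ k * ‖F (k + 1) x‖ₑ := by
          refine ENNReal.tsum_le_tsum fun k => ?_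
          rw [hx k]
          exact ballMaximal_const_mul_le hd (by finiteness) _ x
      _ = ENNReal.ofReal Λ * ∑' k, c ^ (k + 1) * ‖F (k + 1) x‖ₑ := by
          rw [← ENNReal.tsum_mul_left]
          refine tsum_congr fun k => ?_
          rw [← mul_assoc, pow_succ', ← mul_assoc, hΛc, one_mul]
      _ ≤ ENNReal.ofReal Λ * w x := by
          gcongr
          exact ENNReal.tsum_comp_le_tsum_of_injective (add_left_injective 1)
            (fun k => c ^ k * ‖F k x‖ₑ)
  -- With yₖ = βₖ|Fₖ|, w is the average of the yₖ with weights 2^(-k-1), so w^s ≤ sup yₖ^s ≤ Σ yₖ^s.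
  -- The last series is summed in X itself.
  · set β : ℕ → ℝ := fun k => 2 * (2 * Λ⁻¹) ^ k
    have hβ : ∀ k, 0 < β k := fun k => by positivity
    obtain ⟨H, hH, hle, hq⟩ := hX.exists_tsum_le hC htri
      (a := fun k => ((β k ^ s : ℝ) : ℂ) • absPow (F k) s) (E := 4 * X.qnorm (absPow f s))
      (fun k => hX.smul_mem _ _ (hF k).1) (mul_nonneg (by norm_num) (hX.nonneg _ hf)) (fun k => by
        rw [hX.qnorm_smul _ _ (hF k).1, Complex.norm_real,
          Real.norm_of_nonneg (Real.rpow_nonneg (hβ k).le _)]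
        calc β k ^ s * X.qnorm (absPow (F k) s)
            ≤ β k ^ s * ((Q ^ k) ^ s * X.qnorm (absPow f s)) := by gcongr; exact (hF k).2
          _ = 2 ^ s * (((2 * C)⁻¹) ^ k) ^ s * X.qnorm (absPow f s) := by
              have e : β k * Q ^ k = 2 * ((2 * C)⁻¹) ^ k := by
                simp only [β, Λ]
                rw [mul_assoc, ← mul_pow]
                congr 2
                field_simp
                norm_num
              rw [← mul_assoc, ← Real.mul_rpow (hβ k).le (by positivity), e,
                Real.mul_rpow (by norm_num) (by positivity)]
          _ ≤ 4 * ((2 * C)⁻¹) ^ k * X.qnorm (absPow f s) := by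
              have h1 : (2 : ℝ) ^ s ≤ 4 := by
                calc (2 : ℝ) ^ s ≤ 2 ^ (2 : ℝ) :=
                      Real.rpow_le_rpow_of_exponent_le (by norm_num) hs2
                  _ = 4 := by norm_num
              have h2 : (((2 * C)⁻¹) ^ k) ^ s ≤ ((2 * C)⁻¹) ^ k := by
                have hle1 : ((2 * C)⁻¹) ^ k ≤ 1 :=
                  pow_le_one₀ (by positivity) (inv_le_one_of_one_le₀ (by linarith))
                calc _ ≤ (((2 * C)⁻¹) ^ k) ^ (1 : ℝ) :=
                      Real.rpow_le_rpow_of_exponent_ge (by positivity) hle1 hs1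
                  _ = _ := Real.rpow_one _
              have := hX.nonneg _ hf
              gcongr
          _ = _ := by ring)
    refine ⟨H, hH, ?_, hq⟩
    have hcoe : ∀ᵐ x ∂μ, ∀ k, ‖(((β k ^ s : ℝ) : ℂ) • absPow (F k) s) x‖ₑ =
        (ENNReal.ofReal (β k) * ‖F k x‖ₑ) ^ s := ae_all_iff.2 fun k => by
      filter_upwards [AEEqFun.coeFn_smul ((β k ^ s : ℝ) : ℂ) (absPow (F k) s),
        enorm_absPow (F k) hs0] with x h1 h2
      rw [h1, Pi.smul_apply, enorm_smul, h2, ENNReal.mul_rpow_of_nonneg _ _ hs0.le,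
        ENNReal.ofReal_rpow_of_nonneg (hβ k).le hs0.le, ← ofReal_norm, Complex.norm_real,
        Real.norm_of_nonneg (Real.rpow_nonneg (hβ k).le _)]
    filter_upwards [hcoe, hle] with x h1 h2
    refine le_trans ?_ h2
    simp only [h1]
    set y : ℕ → ℝ≥0∞ := fun k => ENNReal.ofReal (β k) * ‖F k x‖ₑ
    have hwy : w x ≤ ⨆ k, y k := by
      calc w x = ∑' k, (2⁻¹ : ℝ≥0∞) ^ (k + 1) * y k := by
            refine tsum_congr fun k => ?_
            have e : ENNReal.ofReal (β k) = 2 ^ (k + 1) * c ^ k := by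
              simp only [β, c]
              rw [mul_pow, ← mul_assoc, ← pow_succ', ENNReal.ofReal_mul (by positivity),
                ENNReal.ofReal_pow (by norm_num), ENNReal.ofReal_pow (by positivity)]
              simp
            simp only [y]
            rw [e, ← mul_assoc, ← mul_assoc, ← mul_pow, ENNReal.inv_mul_cancel (by simp) (by simp),
              one_pow, one_mul]
        _ ≤ ∑' k, (2⁻¹ : ℝ≥0∞) ^ (k + 1) * ⨆ k, y k :=
            ENNReal.tsum_le_tsum fun k => by gcongr; exact le_iSup y k
        _ = _ := by
            rw [ENNReal.tsum_mul_right, ENNReal.tsum_geometric_add_one, ENNReal.one_sub_inv_two,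
              inv_inv, ENNReal.inv_mul_cancel (by simp) (by simp), one_mul]
    have hsup : ⨆ k, y k ≤ (∑' k, y k ^ s) ^ s⁻¹ := iSup_le fun k => by
      rw [ENNReal.le_rpow_inv_iff hs0]
      exact ENNReal.le_tsum (f := fun k => y k ^ s) k
    exact (ENNReal.le_rpow_inv_iff hs0).1 (hwy.trans hsup)

/-- If the norm of the maximal operator on `X^{(s)}` is small compared with `1 / (s - 1)`, then the
operator is bounded on a convexification of `X` with an exponent below `1`. -/
theorem MaximalMajorized.exists_lt_one {C s Q : ℝ} (hd : HasEnlargement d μ K D)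
    (hX : X.IsQuasiBanachLattice) (hC : 1 ≤ C)
    (htri : ∀ f ∈ X.carrier, ∀ g ∈ X.carrier, X.qnorm (f + g) ≤ C * (X.qnorm f + X.qnorm g))
    (hs1 : 1 ≤ s) (hs2 : s ≤ 2) (hQ : 1 ≤ Q) (h : MaximalMajorized d X (Q ^ s) s)
    (hsmall : (s - 1) * Q * (8 * D.toReal ^ 2 * C) < 1) :
    ∃ r B, 0 < r ∧ r < 1 ∧ 0 ≤ B ∧ MaximalMajorized d X B r := by
  have hX' := hX.toIsQuasiNormedLattice
  have hs0 : 0 < s := by positivity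
  have hDt := hd.ne_top
  have hD1 : 1 ≤ D.toReal := by
    simpa using ENNReal.toReal_mono hDt hd.one_le
  have hC0 : 0 < C := by positivity
  have hden : 1 ≤ Q * (8 * D.toReal ^ 2 * C) := by
    have h2 : 1 ≤ D.toReal ^ 2 := one_le_pow₀ hD1
    have h3 : 1 ≤ 8 * D.toReal ^ 2 * C := by nlinarith
    nlinarith
  -- The largest gain that the A₁ constant 4CQ permits: it gives equality in 2D²δ · 4CQ ≤ 1.
  set δ : ℝ := (Q * (8 * D.toReal ^ 2 * C))⁻¹ with hδdef
  have hδ0 : 0 < δ := by positivity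
  have hδ1 : δ ≤ 1 := inv_le_one_of_one_le₀ hden
  have hsδ : s < 1 + δ := by
    rw [← sub_lt_iff_lt_add', hδdef, ← one_div, lt_div_iff₀ (by positivity), ← mul_assoc]
    exact hsmall
  have hp : 0 < 1 + δ := by positivity
  set Λ := ENNReal.ofReal (4 * C * Q)
  have hΛ1 : 1 ≤ Λ := ENNReal.one_le_ofReal.2 (by nlinarith)
  have hΛD : 2 * D * D * ENNReal.ofReal δ * Λ ≤ 1 := by
    have hDr : D = ENNReal.ofReal D.toReal := (ENNReal.ofReal_toReal hDt).symm
    have h2 : (2 : ℝ≥0∞) = ENNReal.ofReal 2 := by simp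
    rw [hDr, h2, ← ENNReal.ofReal_mul (by positivity), ← ENNReal.ofReal_mul (by positivity),
      ← ENNReal.ofReal_mul (by positivity), ← ENNReal.ofReal_mul (by positivity),
      ENNReal.ofReal_le_one]
    refine le_of_eq ?_
    rw [hδdef]
    field_simp
    norm_num
  set r := s / (1 + δ)
  have hr0 : 0 < r := by positivity
  set b : ℝ≥0∞ := (2 * D * 2 * (D * Λ) ^ (1 + δ)) ^ r
  have hb : b ≠ ∞ := by
    have : (D * Λ) ^ (1 + δ) ≠ ∞ := ENNReal.rpow_ne_top_of_nonneg hp.le (by finiteness)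
    exact ENNReal.rpow_ne_top_of_nonneg hr0.le (by finiteness)
  refine ⟨r, b.toReal * (2 * C ^ 2 * 4), hr0, (div_lt_one hp).2 hsδ, by positivity, fun g hg => ?_⟩
  obtain ⟨hf, hqf⟩ := absPow_absPow_mem hX' (p := 1 / (1 + δ)) (by positivity) hs0 hr0
    (by simp only [r]; ring) hg
  obtain ⟨w, hwm, hfw, hA1, H, hH, hwH, hqH⟩ := h.exists_weight hd hX hC htri hs1 hs2 hQ hf
  refine ⟨(b.toReal : ℂ) • H, hX.smul_mem _ _ hH, ?_, ?_⟩
  · have hgw : (fun y => ‖g y‖ₑ) ≤ᵐ[μ] fun y => w y ^ (1 + δ) := by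
      filter_upwards [enorm_absPow g (show 0 < 1 / (1 + δ) by positivity)] with x hx
      have h1 := ENNReal.rpow_le_rpow (hx.symm.trans_le (hfw x)) hp.le
      rwa [← ENNReal.rpow_mul, one_div_mul_cancel hp.ne', ENNReal.rpow_one] at h1
    filter_upwards [hA1, hwH, AEEqFun.coeFn_smul (b.toReal : ℂ) H] with x h1 h2 h3
    rw [h3, Pi.smul_apply, enorm_smul, ← ofReal_norm (b.toReal : ℂ), Complex.norm_real,
      Real.norm_of_nonneg ENNReal.toReal_nonneg, ENNReal.ofReal_toReal hb]
    calc maximalFunction d μ g x ^ r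
        ≤ (2 * D * (2 * (D * ballMaximal d μ w x) ^ (1 + δ))) ^ r := by
          gcongr
          exact (ballMaximal_mono_ae hgw x).trans
            (ballMaximal_rpow_le hd hwm hΛ1 ENNReal.ofReal_ne_top hA1 hδ0 hδ1 hΛD x)
      _ ≤ (2 * D * (2 * (D * (Λ * w x)) ^ (1 + δ))) ^ r := by gcongr
      _ = (2 * D * 2 * (D * Λ) ^ (1 + δ) * w x ^ (1 + δ)) ^ r := by
          rw [← mul_assoc D, ENNReal.mul_rpow_of_nonneg _ _ hp.le]
          ring_nf
      _ = b * w x ^ s := by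
          rw [ENNReal.mul_rpow_of_nonneg _ _ hr0.le, ← ENNReal.rpow_mul, mul_div_cancel₀ _ hp.ne']
      _ ≤ _ := by gcongr
  · rw [hX.qnorm_smul _ _ hH, Complex.norm_real, Real.norm_of_nonneg ENNReal.toReal_nonneg,
      mul_assoc, ← hqf]
    gcongr
    exact hqH.trans_eq (by ring)

end

end FunctionSpace

end

/-! ### The equivalence. -/

open FunctionSpace in
theorem theorem1p1 {Ω : Type*} [TopologicalSpace Ω] [MeasurableSpace Ω] [BorelSpace Ω]
    (d : Ω → Ω → ℝ) (μ : Measure Ω) (hΩ : IsHomogeneousType d μ)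
    (X : FunctionSpace μ) (hX : X.IsQuasiBanachLattice) (hF : X.HasFatouProperty) :
    List.TFAE [
      MaximalBoundedOn d X,
      (∀ s : ℝ, 1 < s → MaximalBoundedOn d (X.convexification s)) ∧
        Tendsto (fun s : ℝ => (s - 1) * maximalOpNorm d (X.convexification s)) (𝓝[>] 1) (𝓝 0),
      ∃ r₀ : ℝ, 0 < r₀ ∧ r₀ < 1 ∧
        ∀ r : ℝ, r₀ ≤ r → r < 1 → MaximalBoundedOn d (X.convexification r)] := by
  obtain ⟨K, D, hd⟩ := hΩ.exists_enlargement
  have hX' := hX.toIsQuasiNormedLattice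
  have hsub : Tendsto (fun s : ℝ => s - 1) (𝓝[>] 1) (𝓝 0) :=
    (by simpa using (continuous_sub_right (1 : ℝ)).tendsto 1 :
      Tendsto (fun s : ℝ => s - 1) (𝓝 1) (𝓝 0)).mono_left nhdsWithin_le_nhds
  tfae_have 1 → 2 := by
    intro h
    obtain ⟨C, hC, hb⟩ := (maximalBoundedOn_iff_majorized hd hX').1 h
    -- Replacing C by max C 1 makes its power 1/s at most itself, a bound independent of s.
    have hb' : ∀ s : ℝ, 1 < s → MaximalMajorized d X (max C 1) s := fun s hs =>
      (hb.mono hX' (le_max_left C 1)).of_le hd hX' one_pos hs.le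
    have hC1 : 1 ≤ max C 1 := le_max_right _ _
    have hbd := fun (s : ℝ) (hs : 1 < s) =>
      (hb' s hs).maximalBoundedOn hd hX' (one_pos.trans hs) (zero_le_one.trans hC1)
    refine ⟨fun s hs => (hbd s hs).1, ?_⟩
    refine squeeze_zero' (g := fun s => (s - 1) * max C 1) ?_ ?_ (by
      simpa using hsub.mul_const (max C 1))
    · filter_upwards [self_mem_nhdsWithin] with s hs
      exact mul_nonneg (sub_nonneg.2 (le_of_lt hs))
        ((hbd s hs).1.majorized_opNorm hX' (one_pos.trans hs)).1
    · filter_upwards [self_mem_nhdsWithin] with s (hs : 1 < s)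
      refine mul_le_mul_of_nonneg_left ((hbd s hs).2.trans ?_) (sub_nonneg.2 hs.le)
      exact Real.rpow_le_self_of_one_le hC1 ((div_le_one (by positivity)).2 hs.le)
  tfae_have 2 → 3 := by
    rintro ⟨hb, hlim⟩
    obtain ⟨C, hC, htri⟩ := hX.quasi_triangle
    -- Q is taken to be the norm plus one, since Q ≥ 1 is needed; the added one costs only s - 1,
    -- which tends to 0.
    have hlim' : Tendsto (fun s : ℝ => (s - 1) * (maximalOpNorm d (X.convexification s) + 1) *
        (8 * D.toReal ^ 2 * C)) (𝓝[>] 1) (𝓝 0) := by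
      have := (hlim.add hsub).mul_const (8 * D.toReal ^ 2 * C)
      simp only [add_zero, zero_mul] at this
      exact this.congr fun s => by ring
    obtain ⟨s, hsmall, hs1', hs2'⟩ := ((hlim'.eventually (gt_mem_nhds one_pos)).and
      (Ioo_mem_nhdsGT (one_lt_two (α := ℝ)))).exists
    obtain ⟨hN0, hN⟩ := (hb s hs1').majorized_opNorm hX' (one_pos.trans hs1')
    obtain ⟨r, B, hr0, hr1, hB, hr⟩ := (hN.mono hX' (Real.rpow_le_rpow hN0
      (le_add_of_nonneg_right zero_le_one) (by linarith))).exists_lt_one hd hX hC htri hs1'.le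
      hs2'.le (le_add_of_nonneg_left hN0) hsmall
    exact ⟨r, hr0, hr1, fun r' hrr' _ =>
      ((hr.of_le hd hX' hr0 hrr').maximalBoundedOn hd hX' (hr0.trans_le hrr') hB).1⟩
  tfae_have 3 → 1 := by
    rintro ⟨r, hr0, hr1, hb⟩
    obtain ⟨hN0, hN⟩ := (hb r le_rfl hr1).majorized_opNorm hX' hr0
    exact (maximalBoundedOn_iff_majorized hd hX').2
      ⟨_, Real.rpow_nonneg hN0 _, hN.of_le hd hX' hr0 hr1.le⟩
  tfae_finish
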